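/- **Theorem 4.1.** Let $\mathbb F$ be a field, let $U,V,W$ be finite-dimensional $\mathbb F$-vector spaces, and let $t\in U\otimes V\otimes W$ be a trilinear form. *Values.* For coordinate tensors $t=\sum t_{ijk}\,x_i\otimes y_j\otimes z_k$ and $t'$ (with respect to bases; the choice is immaterial), $t'$ is a degeneration of $t$, written $t'\unlhd t$, if there are matrices $\alpha,\beta,\gamma$ over $\mathbb F[\lambda]$, an integer $s\ge 0$ and a tensor $t''$ over $\mathbb F[\lambda]$ with $\lambda^s t'+\lambda^{s+1}t''=\sum_{ijk}t_{ijk}\,\alpha(x_i)\otimes\beta(y_j)\otimes\gamma(z_k)$. Let $\langle m,m,m\rangle$ be the tensor $\sum_{a,b,c=1}^m x_{(a,b)}\otimes y_{(b,c)}\otimes z_{(a,c)}$ of $m\times m$ matrix multiplication, let $e\cdot t$ be the direct sum of $e$ copies of $t$, and let $t_{\mathsf C}$, $t_{\mathsf C^2}$ be the cyclic permutations $\sum t_{ijk}\,y_j\otimes z_k\otimes x_i$ and $\sum t_{ijk}\,z_k\otimes x_i\otimes y_j$ of $t$. For $\rho\in[2,3]$ and an integer $N\ge1$ put $$V_{\rho,N}(t)=\max\Big\{(em^\rho)^{\frac1{3N}}\;:\;e,m\in\mathbb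 Z_{\ge1},\ e\cdot\langle m,m,m\rangle\unlhd(t\otimes t_{\mathsf C}\otimes t_{\mathsf C^2})^{\otimes N}\Big\},\qquad V_\rho(t)=\lim_{N\to\infty}V_{\rho,N}(t).$$ *Decompositions.* Suppose that $U=\bigoplus_{i\in I}U_i$, $V=\bigoplus_{j\in J}V_j$, $W=\bigoplus_{k\in K}W_k$ with $I,J,K\subset\mathbb Z$ finite, and $t=\sum_{(i,j,k)\in I\times J\times K}t(i,j,k)$ with $t(i,j,k)\in U_i\otimes V_j\otimes W_k$. Let $S=\{\mathbf s\in I\times J\times K: t(\mathbf s)\ne0\}$ be the support, and assume that $S$ is tight: there is an integer $d$ with $s_1+s_2+s_3=d$ for all $\mathbf s=(s_1,s_2,s_3)\in S$. *Entropy.* For a probability distribution $P$ on $S$ and $\ell\in\{1,2,3\}$, let $P_\ell$ be its $\ell$-th marginal, $P_\ell(a)=\sum_{\mathbf s\in S,\,s_\ell=a}P(\mathbf s)$ for $a$ in the set of $\ell$-th coordinates of elements of $S$. Let $H(P)=-\sum_{\mathbf s}P(\mathbf s)\log P(\mathbf s)$ and $H(P_\ell)=-\sum_aP_\ell(a)\log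 P_\ell(a)$ (with $0\log0=0$), and let $$\Gamma_S(P)=\max_QH(Q)-H(P),$$ where the maximum is over all probability distributions $Q$ on $S$ with $Q_\ell=P_\ell$ for $\ell=1,2,3$. Then, for every probability distribution $P$ on $S$ and every $\rho\in[2,3]$, the values $V_\rho(t)$ and $V_\rho(t(\mathbf s))$, $\mathbf s\in S$, are well defined (the maxima are attained and the limits exist) and positive, and $$\log V_\rho(t)\ \ge\ \sum_{\ell=1}^3\frac{H(P_\ell)}3+\sum_{\mathbf s\in S}P(\mathbf s)\log V_\rho(t(\mathbf s))-\Gamma_S(P).$$ -/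

import Mathlib

open scoped TensorProduct

noncomputable section

/-! ### Coordinate tensors -/

/-- A coordinate tensor: the family of coefficients `t i j k` of `∑ t_{ijk} x_i ⊗ y_j ⊗ z_k`. -/
abbrev CoordTensor (F : Type*) (ι κ μ : Type*) := ι → κ → μ → F

namespace CoordTensor

variable {F : Type*} [Field F] {ι κ μ ι' κ' μ' : Type*}

/-- The tensor of matrix multiplication `⟨m, n, p⟩`:
the coefficient at `x_(r,s) y_(s',t) z_(r',t')` is `1` if `r = r'`, `s = s'`, `t = t'`,
and `0` otherwise. -/
def matMul (F : Type*) [Field F] (m n p : ℕ) :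
    CoordTensor F (Fin m × Fin n) (Fin n × Fin p) (Fin m × Fin p) :=
  fun x y z => if x.1 = z.1 ∧ x.2 = y.1 ∧ y.2 = z.2 then 1 else 0

/-- The cyclic permutation `∑ t_{ijk} y_j ⊗ z_k ⊗ x_i` of `t`. -/
def cyc (t : CoordTensor F ι κ μ) : CoordTensor F κ μ ι :=
  fun j k i => t i j k

/-- The tensor product of two tensors. -/
def prod (t : CoordTensor F ι κ μ) (t' : CoordTensor F ι' κ' μ') :
    CoordTensor F (ι × ι') (κ × κ') (μ × μ') :=
  fun i j k => t i.1 j.1 k.1 * t' i.2 j.2 k.2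

/-- The tensor power `t ⊗ ⋯ ⊗ t` with `N` factors. -/
def power (t : CoordTensor F ι κ μ) (N : ℕ) :
    CoordTensor F (Fin N → ι) (Fin N → κ) (Fin N → μ) :=
  fun i j k => ∏ l, t (i l) (j l) (k l)

/-- The direct sum `t ⊕ ⋯ ⊕ t` of `e` copies of `t`. -/
def copies (e : ℕ) (t : CoordTensor F ι κ μ) :
    CoordTensor F (Fin e × ι) (Fin e × κ) (Fin e × μ) :=
  fun i j k => if i.1 = j.1 ∧ j.1 = k.1 then t i.2 j.2 k.2 else 0

/-- `IsDegeneration t' t` means that `t'` is a degeneration of `t`: there are matrices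
`α, β, γ` over `F[X]`, an exponent `s` and a tensor `t''` over `F[X]` with
`X ^ s t' + X ^ (s + 1) t'' = ∑ t_{ijk} α(x_i) ⊗ β(y_j) ⊗ γ(z_k)`. -/
def IsDegeneration [Fintype ι] [Fintype κ] [Fintype μ]
    (t' : CoordTensor F ι' κ' μ') (t : CoordTensor F ι κ μ) : Prop :=
  ∃ (α : Matrix ι' ι (Polynomial F)) (β : Matrix κ' κ (Polynomial F))
    (γ : Matrix μ' μ (Polynomial F)) (s : ℕ) (t'' : ι' → κ' → μ' → Polynomial F),
    ∀ i' j' k',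
      Polynomial.X ^ s * Polynomial.C (t' i' j' k') + Polynomial.X ^ (s + 1) * t'' i' j' k' =
        ∑ i, ∑ j, ∑ k, Polynomial.C (t i j k) * (α i' i * β j' j * γ k' k)

variable [Fintype ι] [Fintype κ] [Fintype μ]

/-- The pairs `(e, m)` of positive integers such that `e · ⟨m, m, m⟩` is a degeneration of
`(t ⊗ t_C ⊗ t_{C²})^{⊗ N}`. -/
def matMulPairs (N : ℕ) (t : CoordTensor F ι κ μ) : Set (ℕ × ℕ) :=
  {p | 0 < p.1 ∧ 0 < p.2 ∧
    IsDegeneration (copies p.1 (matMul F p.2 p.2 p.2))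
      (power (prod (prod t (cyc t)) (cyc (cyc t))) N)}

/-- The numbers `(e m ^ ρ) ^ (1 / (3 N))` for `(e, m)` in `matMulPairs N t`. -/
def valueSet (ρ : ℝ) (N : ℕ) (t : CoordTensor F ι κ μ) : Set ℝ :=
  (fun p : ℕ × ℕ => ((p.1 : ℝ) * (p.2 : ℝ) ^ ρ) ^ (1 / (3 * (N : ℝ)))) '' matMulPairs N t

/-- `V_{ρ,N}(t)`, the maximum of `valueSet ρ N t`. -/
def valueN (ρ : ℝ) (N : ℕ) (t : CoordTensor F ι κ μ) : ℝ :=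
  sSup (valueSet ρ N t)

/-- The value `V_ρ(t)`, the limit of `V_{ρ,N}(t)` as `N → ∞`. -/
def value (ρ : ℝ) (t : CoordTensor F ι κ μ) : ℝ :=
  Filter.limUnder Filter.atTop (fun N : ℕ => valueN ρ N t)

/-- The value of `t` is well defined and positive: for `N ≥ 1` the maximum defining `V_{ρ,N}(t)`
is attained, the limit defining `V_ρ(t)` exists, and it is positive. -/
def ValueWellDefined (ρ : ℝ) (t : CoordTensor F ι κ μ) : Prop :=
  (∀ N : ℕ, 1 ≤ N → IsGreatest (valueSet ρ N t) (valueN ρ N t)) ∧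
    Filter.Tendsto (fun N : ℕ => valueN ρ N t) Filter.atTop (nhds (value ρ t)) ∧
    0 < value ρ t

end CoordTensor

/-! ### Trilinear forms on finite-dimensional vector spaces and their decompositions -/

section Trilinear

variable {F : Type*} [Field F] {U V W : Type*}
  [AddCommGroup U] [Module F U] [AddCommGroup V] [Module F V] [AddCommGroup W] [Module F W]

/-- The coefficients of `t` with respect to bases of `U`, `V` and `W`. -/
def tensorCoeffs {ι κ μ : Type*} (bU : Module.Basis ι F U) (bV : Module.Basis κ F V)
    (bW : Module.Basis μ F W) (t : (U ⊗[F] V) ⊗[F] W) : CoordTensor F ι κ μ :=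
  fun i j k => ((bU.tensorProduct bV).tensorProduct bW).repr t ((i, j), k)

variable [FiniteDimensional F U] [FiniteDimensional F V] [FiniteDimensional F W]

/-- The coefficients of `t` with respect to fixed bases of `U`, `V` and `W`. -/
def tensorCoords (t : (U ⊗[F] V) ⊗[F] W) :
    CoordTensor F (Fin (Module.finrank F U)) (Fin (Module.finrank F V))
      (Fin (Module.finrank F W)) :=
  tensorCoeffs (Module.finBasis F U) (Module.finBasis F V) (Module.finBasis F W) t

/-- The value `V_ρ(t)` of a trilinear form. -/
def tensorValue (ρ : ℝ) (t : (U ⊗[F] V) ⊗[F] W) : ℝ :=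
  (tensorCoords t).value ρ

/-- The value of the trilinear form `t` is well defined and positive. -/
def TensorValueWellDefined (ρ : ℝ) (t : (U ⊗[F] V) ⊗[F] W) : Prop :=
  (tensorCoords t).ValueWellDefined ρ

end Trilinear

/-- A decomposition of a trilinear form `t`: decompositions `U = ⨁_{i ∈ I} U_i`,
`V = ⨁_{j ∈ J} V_j`, `W = ⨁_{k ∈ K} W_k` indexed by finite sets of integers (the summands are
extended by `0` outside `I`, `J`, `K`), together with tensors `t(i,j,k) ∈ U_i ⊗ V_j ⊗ W_k`
whose sum is `t`. -/
structure TensorDecomposition {F : Type*} [Field F] {U V W : Type*}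
    [AddCommGroup U] [Module F U] [AddCommGroup V] [Module F V] [AddCommGroup W] [Module F W]
    (t : (U ⊗[F] V) ⊗[F] W) where
  I : Finset ℤ
  J : Finset ℤ
  K : Finset ℤ
  subU : ℤ → Submodule F U
  subV : ℤ → Submodule F V
  subW : ℤ → Submodule F W
  subU_eq_bot : ∀ i, i ∉ I → subU i = ⊥
  subV_eq_bot : ∀ j, j ∉ J → subV j = ⊥
  subW_eq_bot : ∀ k, k ∉ K → subW k = ⊥
  isInternal_subU : DirectSum.IsInternal subU
  isInternal_subV : DirectSum.IsInternal subV
  isInternal_subW : DirectSum.IsInternal subW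
  /-- The tensor `t(i,j,k)` for `s = (i,j,k)`. -/
  comp : ∀ s : ℤ × ℤ × ℤ, (subU s.1 ⊗[F] subV s.2.1) ⊗[F] subW s.2.2
  sum_comp : ∑ s ∈ I ×ˢ J ×ˢ K,
    TensorProduct.map (TensorProduct.map (subU s.1).subtype (subV s.2.1).subtype)
      (subW s.2.2).subtype (comp s) = t

open Classical in
/-- The support of `t` with respect to the decomposition. -/
def TensorDecomposition.supp {F : Type*} [Field F] {U V W : Type*}
    [AddCommGroup U] [Module F U] [AddCommGroup V] [Module F V] [AddCommGroup W] [Module F W]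
    {t : (U ⊗[F] V) ⊗[F] W} (D : TensorDecomposition t) : Finset (ℤ × ℤ × ℤ) :=
  {s ∈ D.I ×ˢ D.J ×ˢ D.K | D.comp s ≠ 0}

/-! ### Tightness, marginals, entropy -/

/-- The coordinate functions on `ℤ × ℤ × ℤ`. -/
def tripleCoord : Fin 3 → ℤ × ℤ × ℤ → ℤ :=
  ![fun s => s.1, fun s => s.2.1, fun s => s.2.2]

/-- `S` is tight if the sum of the coordinates is constant on `S`. -/
def IsTightSupport (S : Finset (ℤ × ℤ × ℤ)) : Prop :=
  ∃ d : ℤ, ∀ s ∈ S, s.1 + s.2.1 + s.2.2 = d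

/-- The marginal function `f_ℓ(a) = ∑_{s ∈ S, s_ℓ = a} f(s)`. -/
def marginalFun {S : Finset (ℤ × ℤ × ℤ)} (l : Fin 3) (f : S → ℝ) (a : ℤ) : ℝ :=
  ∑ s : S with tripleCoord l s.1 = a, f s

/-- The entropy `H(P) = - ∑_{s ∈ S} P(s) log P(s)`. -/
def entropyOn {S : Finset (ℤ × ℤ × ℤ)} (P : S → ℝ) : ℝ :=
  ∑ s, Real.negMulLog (P s)

/-- The entropy `H(P_ℓ)` of a marginal of `P`, a sum over the `ℓ`-th coordinates of
elements of `S`. -/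
def marginalEntropy {S : Finset (ℤ × ℤ × ℤ)} (l : Fin 3) (P : S → ℝ) : ℝ :=
  ∑ a ∈ S.image (tripleCoord l), Real.negMulLog (marginalFun l P a)

/-- The probability distributions on `S` that have the same three marginals as `P`. -/
def compatibleDistributions {S : Finset (ℤ × ℤ × ℤ)} (P : S → ℝ) : Set (S → ℝ) :=
  {Q | Q ∈ stdSimplex ℝ S ∧ ∀ l, ∀ a ∈ S.image (tripleCoord l),
    marginalFun l P a = marginalFun l Q a}

/-- `Γ_S(P)`: the maximum of `H(Q)` over the distributions `Q` compatible with `P`,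
minus `H(P)`. -/
def entropyGap {S : Finset (ℤ × ℤ × ℤ)} (P : S → ℝ) : ℝ :=
  sSup (entropyOn '' compatibleDistributions P) - entropyOn P

/-- The maximum in the definition of `Γ_S(P)` is attained. -/
theorem isGreatest_entropyOn_compatible {S : Finset (ℤ × ℤ × ℤ)} (P : S → ℝ)
    (hP : P ∈ stdSimplex ℝ S) :
    IsGreatest (entropyOn '' compatibleDistributions P)
      (sSup (entropyOn '' compatibleDistributions P)) := by
  have hc : IsCompact (compatibleDistributions P) := by
    have h1 : compatibleDistributions P = stdSimplex ℝ S ∩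
        ⋂ l, ⋂ a ∈ S.image (tripleCoord l), {Q | marginalFun l P a = marginalFun l Q a} := by
      ext Q
      simp only [compatibleDistributions, Set.mem_ofPred_eq, Set.mem_inter_iff, Set.mem_iInter]
    rw [h1]
    refine (isCompact_stdSimplex ℝ S).inter_right ?_
    refine isClosed_iInter fun l => isClosed_biInter fun a _ => ?_
    refine isClosed_eq continuous_const ?_
    unfold marginalFun
    fun_prop
  have hcont : Continuous (entropyOn (S := S)) := by
    unfold entropyOn
    exact continuous_finsetSum _ fun s _ => Real.continuous_negMulLog.comp (continuous_apply s)
  exact (hc.image hcont).isGreatest_sSup ⟨_, P, ⟨hP, fun _ _ _ => rfl⟩, rfl⟩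

end

/-! For a tensor u let `logMax` be the largest log e + ρ log m over the pairs with e · ⟨m,m,m⟩ a
degeneration of u. It is superadditive under tensor products, monotone under restriction and bounded
through the flattening rank. By Fekete's lemma, with T = t ⊗ t_C ⊗ t_{C²}, the quotient
`logMax`(T^{⊗N}) / N converges to its supremum, which is 3 log V_ρ(t) (`tendsto_valueN`). It remains
to bound `logMax`(T^{⊗N}) from below, and this is the laser method.

The decomposition of t cuts T^{⊗N} into blocks indexed by triples of sequences in S^N. Choose counts
c with c/N → P. About exp(3N H(P)) triples have all three sequences of type c
(`le_log_card_typeClass`). Each of their blocks is, up to reordering, the product over s of the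
symmetrized t(s) to the power c(s), so it contributes about 3N ∑ P(s) log V_ρ(t(s))
(`isRestriction_degrees_block`).

Contributions of different blocks add up when no nonzero block takes its three coordinates from
distinct selected ones (`card_mul_mem_pairs`). A given coordinate lies on at most R ≈ exp(N(3 max
H(Q) − ∑ H(P_ℓ))) triples with the right marginals (`card_cycBlock_fiber_le`); the cyclic
symmetrization makes this bound the same for all three coordinates. Tightness allows an affine hash
modulo a prime M of order R into a progression-free set of Behrend's size, and some choice of the
hash keeps a fraction M^{-1-o(1)} of the triples without interactions (`exists_isolated_subset`,
`exists_isolated_triples`). Thus exp(N(∑ H(P_ℓ) − 3Γ_S(P)) − o(N)) blocks survive; dividing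
logarithms by 3N gives the bound. -/

noncomputable section

/-! ### Degenerations, restrictions and sums of matrix multiplication tensors -/

namespace CoordTensor

open Polynomial

variable {F : Type*} [Field F] {ι κ μ ι' κ' μ' : Type*}
  [Fintype ι] [Fintype κ] [Fintype μ] [Fintype ι'] [Fintype κ'] [Fintype μ']

/-- Collecting the left side into one polynomial q with constant term t' makes degenerations
multiplicative: the exponents add and the q's multiply, with no error term to expand. -/
theorem isDegeneration_iff {ι' κ' μ' : Type*} {t' : CoordTensor F ι' κ' μ'}
    {t : CoordTensor F ι κ μ} :
    IsDegeneration t' t ↔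
      ∃ (α : Matrix ι' ι F[X]) (β : Matrix κ' κ F[X]) (γ : Matrix μ' μ F[X]) (s : ℕ)
        (q : ι' → κ' → μ' → F[X]), ∀ i' j' k',
          X ^ s * q i' j' k' = ∑ i, ∑ j, ∑ k, C (t i j k) * (α i' i * β j' j * γ k' k) ∧
            (q i' j' k').eval 0 = t' i' j' k' := by
  constructor
  · rintro ⟨α, β, γ, s, t'', h⟩
    refine ⟨α, β, γ, s, fun i j k => C (t' i j k) + X * t'' i j k, fun i j k => ⟨?_, by simp⟩⟩
    rw [← h]; ring
  · rintro ⟨α, β, γ, s, q, h⟩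
    refine ⟨α, β, γ, s, fun i j k => (q i j k).divX, fun i j k => ?_⟩
    obtain ⟨h1, h2⟩ := h i j k
    rw [← h1, ← h2, ← coeff_zero_eq_eval_zero]
    conv_rhs => rw [← divX_mul_X_add (q i j k)]
    ring

/-- Pulling back along index maps preserves degenerations. -/
theorem IsDegeneration.comap {ι₁ κ₁ μ₁ ι₂ κ₂ μ₂ : Type*} {t' : CoordTensor F ι₁ κ₁ μ₁}
    {t : CoordTensor F ι κ μ} (h : IsDegeneration t' t)
    (f : ι₂ → ι₁) (g : κ₂ → κ₁) (l : μ₂ → μ₁) :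
    IsDegeneration (fun i j k => t' (f i) (g j) (l k)) t := by
  obtain ⟨α, β, γ, s, q, h⟩ := isDegeneration_iff.1 h
  exact isDegeneration_iff.2 ⟨fun i => α (f i), fun j => β (g j), fun k => γ (l k), s,
    fun i j k => q (f i) (g j) (l k), fun i j k => h _ _ _⟩

/-- `t` is a restriction of `t'`. -/
def IsRestriction (t : CoordTensor F ι κ μ) (t' : CoordTensor F ι' κ' μ') : Prop :=
  ∃ (a : ι → ι' → F) (b : κ → κ' → F) (c : μ → μ' → F), ∀ i j k,
    t i j k = ∑ i', ∑ j', ∑ k', t' i' j' k' * (a i i' * b j j' * c k k')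

omit [Fintype ι] [Fintype κ] [Fintype μ] in
theorem IsRestriction.of_comap {t : CoordTensor F ι κ μ} {t' : CoordTensor F ι' κ' μ'}
    (f : ι → ι') (g : κ → κ') (l : μ → μ') (h : ∀ i j k, t i j k = t' (f i) (g j) (l k)) :
    IsRestriction t t' := by
  classical
  refine ⟨fun i i' => if f i = i' then 1 else 0, fun i i' => if g i = i' then 1 else 0,
    fun i i' => if l i = i' then 1 else 0, fun i j k => ?_⟩
  simp [h, mul_ite]

omit [Fintype ι] [Fintype κ] [Fintype μ] in
theorem IsRestriction.ne_zero {t : CoordTensor F ι κ μ} {t' : CoordTensor F ι' κ' μ'}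
    (h : IsRestriction t t') (ht : t ≠ 0) : t' ≠ 0 := by
  rintro rfl
  obtain ⟨a, b, c, h⟩ := h
  exact ht (by ext i j k; simp [h])

/-- Applying a triple of matrices and then a triple of functionals is the same as applying the
composites. This is what composes a restriction with a degeneration. -/
theorem sum_triple_comm {R : Type*} [CommSemiring R] (t : ι' → κ' → μ' → R)
    (a : ι → ι' → R) (b : κ → κ' → R) (c : μ → μ' → R) (α : ι → R) (β : κ → R) (γ : μ → R) :
    ∑ i, ∑ j, ∑ k, (∑ i', ∑ j', ∑ k', t i' j' k' * (a i i' * b j j' * c k k')) *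
        (α i * β j * γ k) =
      ∑ i', ∑ j', ∑ k', t i' j' k' *
        ((∑ i, α i * a i i') * (∑ j, β j * b j j') * (∑ k, γ k * c k k')) := by
  have e1 : ∀ G : ι → κ → μ → R, ∑ i, ∑ j, ∑ k, G i j k =
      ∑ p : ι × κ × μ, G p.1 p.2.1 p.2.2 := fun G => by simp [Fintype.sum_prod_type]
  have e2 : ∀ G : ι' → κ' → μ' → R, ∑ i, ∑ j, ∑ k, G i j k =
      ∑ p : ι' × κ' × μ', G p.1 p.2.1 p.2.2 := fun G => by simp [Fintype.sum_prod_type]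
  rw [e1, e2]
  simp_rw [e2]
  conv_lhs => simp only [Finset.sum_mul]
  rw [Finset.sum_comm]
  refine Finset.sum_congr rfl fun p' _ => ?_
  have e3 : (∑ i, α i * a i p'.1) * (∑ j, β j * b j p'.2.1) * (∑ k, γ k * c k p'.2.2) =
      ∑ i, ∑ j, ∑ k, (α i * a i p'.1) * (β j * b j p'.2.1) * (γ k * c k p'.2.2) := by
    rw [Finset.sum_mul_sum, Finset.sum_mul]
    refine Finset.sum_congr rfl fun i _ => ?_
    rw [Finset.sum_mul]
    refine Finset.sum_congr rfl fun j _ => ?_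
    rw [Finset.mul_sum]
  rw [e3, e1, Finset.mul_sum]
  refine Finset.sum_congr rfl fun p _ => ?_
  ring

theorem IsDegeneration.of_isRestriction {ι₁ κ₁ μ₁ : Type*} {u : CoordTensor F ι₁ κ₁ μ₁}
    {t : CoordTensor F ι κ μ} {t' : CoordTensor F ι' κ' μ'} (h : IsDegeneration u t)
    (h' : IsRestriction t t') : IsDegeneration u t' := by
  obtain ⟨a, b, c, h'⟩ := h'
  obtain ⟨α, β, γ, s, q, h⟩ := isDegeneration_iff.1 h
  refine isDegeneration_iff.2 ⟨fun i' i => ∑ x, α i' x * C (a x i),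
    fun j' j => ∑ x, β j' x * C (b x j), fun k' k => ∑ x, γ k' x * C (c x k), s, q,
    fun i' j' k' => ⟨?_, (h i' j' k').2⟩⟩
  rw [(h i' j' k').1, ← sum_triple_comm (fun i j k => C (t' i j k)) (fun i j => C (a i j))
    (fun i j => C (b i j)) (fun i j => C (c i j))]
  simp [h']

/-- Direct sum, indexed by `E`, of copies of the matrix multiplication tensor of matrices
indexed by `A`. -/
def mmT (F : Type*) [Field F] (E A : Type*) :
    CoordTensor F (E × A × A) (E × A × A) (E × A × A) :=
  open Classical in fun x y z =>
    if x.1 = y.1 ∧ y.1 = z.1 ∧ x.2.1 = z.2.1 ∧ x.2.2 = y.2.1 ∧ y.2.2 = z.2.2 then 1 else 0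

/-- The pairs `(e, m)` of positive integers such that `e · ⟨m, m, m⟩` is a degeneration
of `t`. -/
def pairs (t : CoordTensor F ι κ μ) : Set (ℕ × ℕ) :=
  {p | 0 < p.1 ∧ 0 < p.2 ∧ IsDegeneration (copies p.1 (matMul F p.2 p.2 p.2)) t}

theorem copies_matMul_eq (e m : ℕ) :
    copies e (matMul F m m m) = mmT F (Fin e) (Fin m) := by
  ext x y z
  simp only [copies, matMul, mmT]
  split_ifs <;> tauto

theorem isDegeneration_mmT_of_equiv {E A E' A' : Type*} (eE : E ≃ E') (eA : A ≃ A')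
    {t : CoordTensor F ι κ μ} (h : IsDegeneration (mmT F E A) t) :
    IsDegeneration (mmT F E' A') t := by
  classical
  let f : E' × A' × A' → E × A × A := fun p => (eE.symm p.1, eA.symm p.2.1, eA.symm p.2.2)
  convert h.comap f f f using 1
  ext x y z
  simp only [mmT, f]
  exact if_congr (by simp) rfl rfl

theorem mem_pairs_iff {t : CoordTensor F ι κ μ} {p : ℕ × ℕ} :
    p ∈ pairs t ↔ 0 < p.1 ∧ 0 < p.2 ∧ IsDegeneration (mmT F (Fin p.1) (Fin p.2)) t := by
  rw [pairs, Set.mem_ofPred_eq, copies_matMul_eq]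

theorem mem_pairs_of_mmT {E A : Type*} [Fintype E] [Fintype A] [Nonempty E] [Nonempty A]
    {t : CoordTensor F ι κ μ} (h : IsDegeneration (mmT F E A) t) :
    (Fintype.card E, Fintype.card A) ∈ pairs t :=
  mem_pairs_iff.2 ⟨Fintype.card_pos, Fintype.card_pos,
    isDegeneration_mmT_of_equiv (Fintype.equivFin E) (Fintype.equivFin A) h⟩

theorem pairs_mono {t : CoordTensor F ι κ μ} {t' : CoordTensor F ι' κ' μ'}
    (h : IsRestriction t t') : pairs t ⊆ pairs t' :=
  fun _ hp => ⟨hp.1, hp.2.1, hp.2.2.of_isRestriction h⟩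

theorem one_mem_pairs {t : CoordTensor F ι κ μ} (ht : t ≠ 0) : (1, 1) ∈ pairs t := by
  classical
  have h : ∃ i j k, t i j k ≠ 0 := by
    by_contra! h
    exact ht (by ext i j k; simp [h])
  obtain ⟨i, j, k, h⟩ := h
  rw [mem_pairs_iff]
  refine ⟨one_pos, one_pos, ?_⟩
  refine isDegeneration_iff.2 ⟨fun _ x => if i = x then C (t i j k)⁻¹ else 0,
    fun _ x => if j = x then 1 else 0, fun _ x => if k = x then 1 else 0, 0, fun _ _ _ => 1,
    fun i' j' k' => ⟨?_, ?_⟩⟩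
  · have : C (t i j k) * C (t i j k)⁻¹ = (1 : F[X]) := by rw [← C_mul, mul_inv_cancel₀ h, C_1]
    simp [mul_ite, this]
  · simp [mmT, eq_iff_true_of_subsingleton]

/-- The tensor product of a finite family of tensors. -/
def piProd {L : Type*} [Fintype L] {ι κ μ : L → Type*}
    (A : ∀ l, CoordTensor F (ι l) (κ l) (μ l)) :
    CoordTensor F (∀ l, ι l) (∀ l, κ l) (∀ l, μ l) :=
  fun i j k => ∏ l, A l (i l) (j l) (k l)

theorem IsDegeneration.piProd {L : Type*} [Fintype L] [DecidableEq L] {ι κ μ ι' κ' μ' : L → Type*}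
    [∀ l, Fintype (ι l)] [∀ l, Fintype (κ l)] [∀ l, Fintype (μ l)]
    {A' : ∀ l, CoordTensor F (ι' l) (κ' l) (μ' l)} {A : ∀ l, CoordTensor F (ι l) (κ l) (μ l)}
    (h : ∀ l, IsDegeneration (A' l) (A l)) :
    IsDegeneration (piProd A') (piProd A) := by
  choose α β γ s q h using fun l => isDegeneration_iff.1 (h l)
  refine isDegeneration_iff.2 ⟨fun i' i => ∏ l, α l (i' l) (i l),
    fun j' j => ∏ l, β l (j' l) (j l), fun k' k => ∏ l, γ l (k' l) (k l), ∑ l, s l,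
    fun i' j' k' => ∏ l, q l (i' l) (j' l) (k' l), fun i' j' k' => ⟨?_, ?_⟩⟩
  · rw [← Finset.prod_pow_eq_pow_sum, ← Finset.prod_mul_distrib]
    simp_rw [(h _ _ _ _).1, Finset.prod_univ_sum, Fintype.piFinset_univ, CoordTensor.piProd,
      map_prod, Finset.prod_mul_distrib]
  · rw [eval_prod]
    simp_rw [(h _ _ _ _).2, CoordTensor.piProd]

/-- Matrix multiplication tensors are closed under Kronecker products: with product index types the
defining equalities of `mmT` hold exactly when they hold in every factor. -/
theorem prod_mem_pairs_piProd {L : Type*} [Fintype L] [DecidableEq L] {ι κ μ : L → Type*}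
    [∀ l, Fintype (ι l)] [∀ l, Fintype (κ l)] [∀ l, Fintype (μ l)]
    {A : ∀ l, CoordTensor F (ι l) (κ l) (μ l)} {p : L → ℕ × ℕ} (h : ∀ l, p l ∈ pairs (A l)) :
    (∏ l, (p l).1, ∏ l, (p l).2) ∈ pairs (piProd A) := by
  simp_rw [mem_pairs_iff] at h
  have := fun l => (Fin.pos_iff_nonempty.1 (h l).1)
  have := fun l => (Fin.pos_iff_nonempty.1 (h l).2.1)
  have h1 := IsDegeneration.piProd fun l => (h l).2.2
  let f : (∀ l, Fin (p l).1) × (∀ l, Fin (p l).2) × (∀ l, Fin (p l).2) →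
      ∀ l, Fin (p l).1 × Fin (p l).2 × Fin (p l).2 := fun x l => (x.1 l, x.2.1 l, x.2.2 l)
  have h2 : IsDegeneration (mmT F (∀ l, Fin (p l).1) (∀ l, Fin (p l).2)) (piProd A) := by
    convert h1.comap f f f using 1
    ext x y z
    simp only [mmT, piProd, f, funext_iff, ← forall_and]
    split_ifs with hc
    · exact (Finset.prod_eq_one fun l _ => if_pos (hc l)).symm
    · obtain ⟨l, hl⟩ := not_forall.1 hc
      exact (Finset.prod_eq_zero (Finset.mem_univ l) (if_neg hl)).symm
  simpa using mem_pairs_of_mmT h2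

/-- If the blocks of `t` indexed by `G` do not interact, then degenerations of the single
blocks add up. -/
theorem card_mul_mem_pairs {G T₁ T₂ T₃ : Type*} [Fintype G] [Nonempty G]
    [DecidableEq T₁] [DecidableEq T₂] [DecidableEq T₃] (t : CoordTensor F ι κ μ)
    (x : ι → T₁) (y : κ → T₂) (z : μ → T₃) (a : G → T₁) (b : G → T₂) (c : G → T₃)
    (hiso : ∀ g₁ g₂ g₃ i j k, x i = a g₁ → y j = b g₂ → z k = c g₃ → t i j k ≠ 0 →
      g₁ = g₂ ∧ g₂ = g₃) {e m : ℕ}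
    (h : ∀ g, (e, m) ∈ pairs (fun i j k => if x i = a g ∧ y j = b g ∧ z k = c g then
      t i j k else 0)) :
    (Fintype.card G * e, m) ∈ pairs t := by
  classical
  simp_rw [mem_pairs_iff] at h
  have he : Nonempty (Fin e) := Fin.pos_iff_nonempty.1 (h (Classical.arbitrary G)).1
  have hm : Nonempty (Fin m) := Fin.pos_iff_nonempty.1 (h (Classical.arbitrary G)).2.1
  choose α β γ s q h using fun g => isDegeneration_iff.1 (h g).2.2
  have key : IsDegeneration (mmT F (G × Fin e) (Fin m)) t := by
    -- Each matrix is cut down to the indices of its own block. The blocks may degenerate with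
    -- different exponents `s g`, so the first matrix carries an extra power of X that raises all of
    -- them to the common exponent `∑ g, s g`.
    refine isDegeneration_iff.2 ⟨fun i' i => if x i = a i'.1.1 then
        (X : F[X]) ^ (∑ g, s g - s i'.1.1) * α i'.1.1 (i'.1.2, i'.2) i else 0,
      fun j' j => if y j = b j'.1.1 then β j'.1.1 (j'.1.2, j'.2) j else 0,
      fun k' k => if z k = c k'.1.1 then γ k'.1.1 (k'.1.2, k'.2) k else 0, ∑ g, s g,
      fun i' j' k' => if i'.1.1 = j'.1.1 ∧ j'.1.1 = k'.1.1 then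
        q i'.1.1 (i'.1.2, i'.2) (j'.1.2, j'.2) (k'.1.2, k'.2) else 0, ?_⟩
    rintro ⟨⟨g₁, i'⟩, ii⟩ ⟨⟨g₂, j'⟩, jj⟩ ⟨⟨g₃, k'⟩, kk⟩
    by_cases hg : g₁ = g₂ ∧ g₂ = g₃
    · obtain ⟨rfl, rfl⟩ := hg
      obtain ⟨h1, h2⟩ := h g₁ (i', ii) (j', jj) (k', kk)
      have hs : s g₁ ≤ ∑ g, s g := Finset.single_le_sum (fun _ _ => Nat.zero_le _)
        (Finset.mem_univ g₁)
      constructor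
      · simp only [and_self, if_true]
        rw [← Nat.sub_add_cancel hs, pow_add, mul_assoc, h1, Finset.mul_sum]
        refine Finset.sum_congr rfl fun i _ => ?_
        rw [Finset.mul_sum]
        refine Finset.sum_congr rfl fun j _ => ?_
        rw [Finset.mul_sum]
        refine Finset.sum_congr rfl fun k _ => ?_
        rw [Nat.sub_add_cancel hs]
        by_cases hx : x i = a g₁ <;> by_cases hy : y j = b g₁ <;> by_cases hz : z k = c g₁ <;>
          simp [hx, hy, hz]
        ring
      · simp only [and_self, if_true]
        rw [h2]
        simp [mmT]
    · constructor
      · simp only [if_neg hg, mul_zero]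
        symm
        refine Finset.sum_eq_zero fun i _ => Finset.sum_eq_zero fun j _ =>
          Finset.sum_eq_zero fun k _ => ?_
        by_cases hx : x i = a g₁ <;> by_cases hy : y j = b g₂ <;> by_cases hz : z k = c g₃ <;>
          simp [hx, hy, hz]
        left
        by_contra ht
        exact hg (hiso _ _ _ _ _ _ hx hy hz ht)
      · simp only [if_neg hg]
        simp only [mmT, Prod.mk.injEq, eval_zero]
        rw [if_neg]
        tauto
  simpa using mem_pairs_of_mmT key

/-- The flattening rank bound. -/
theorem mul_sq_le_card_of_mem_pairs {t : CoordTensor F ι κ μ} {p : ℕ × ℕ} (hp : p ∈ pairs t) :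
    p.1 * p.2 ^ 2 ≤ Fintype.card ι := by
  classical
  obtain ⟨e, m⟩ := p
  obtain ⟨-, hm, h⟩ := mem_pairs_iff.1 hp
  obtain ⟨α, β, γ, s, q, h⟩ := isDegeneration_iff.1 h
  simp only at hm
  let o : Fin m := ⟨0, hm⟩
  let D := Fin e × Fin m × Fin m
  -- For each c there is exactly one x-index that pairs with `fy c` and `fz c`, namely c itself. On
  -- these columns the flattening is the identity matrix of size e m².
  let fy : D → D := fun c => (c.1, c.2.2, o)
  let fz : D → D := fun c => (c.1, c.2.1, o)
  let Q : Matrix D D F[X] := fun r c => q r (fy c) (fz c)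
  let Bm : Matrix ι D F[X] := fun i c => ∑ j, ∑ k, C (t i j k) * (β (fy c) j * γ (fz c) k)
  have hQ : (X ^ s : F[X]) • Q = (α : Matrix D ι F[X]) * Bm := by
    ext1 r c
    rw [Matrix.smul_apply, smul_eq_mul, (h r (fy c) (fz c)).1, Matrix.mul_apply]
    refine Finset.sum_congr rfl fun i _ => ?_
    rw [Finset.mul_sum]
    refine Finset.sum_congr rfl fun j _ => ?_
    rw [Finset.mul_sum]
    refine Finset.sum_congr rfl fun k _ => ?_
    ring
  have hQ0 : (evalRingHom (0 : F)).mapMatrix Q = 1 := by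
    ext r c
    have : (evalRingHom (0 : F)).mapMatrix Q r c = mmT F (Fin e) (Fin m) r (fy c) (fz c) :=
      (h r (fy c) (fz c)).2
    rw [this, Matrix.one_apply]
    simp only [mmT, fy, fz]
    refine if_congr ?_ rfl rfl
    constructor
    · rintro ⟨h1, -, h2, h3, -⟩
      exact Prod.ext h1 (Prod.ext h2 h3)
    · rintro rfl
      simp
  -- At X = 0 the determinant of Q is 1, so the matrix is nonsingular over F[X]; since it factors
  -- through ι, the rank bound follows.
  have hdet : ((X ^ s : F[X]) • Q).det ≠ 0 := by
    rw [Matrix.det_smul]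
    refine mul_ne_zero (pow_ne_zero _ (pow_ne_zero _ X_ne_zero)) fun h0 => ?_
    have := congrArg (evalRingHom (0 : F)) h0
    rw [RingHom.map_det, hQ0] at this
    simp at this
  have hinj : Function.Injective (Matrix.vecMulLinear (α : Matrix D ι F[X])) := by
    rw [← LinearMap.ker_eq_bot, LinearMap.ker_eq_bot']
    intro v hv
    by_contra hv0
    refine hdet (Matrix.exists_vecMul_eq_zero_iff.1 ⟨v, hv0, ?_⟩)
    rw [hQ, ← Matrix.vecMul_vecMul]
    have : Matrix.vecMul v α = 0 := hv
    rw [this, Matrix.zero_vecMul]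
  have := card_le_of_injective' (R := F[X])
    ((Finsupp.linearEquivFunOnFinite F[X] F[X] ι).symm.toLinearMap ∘ₗ
      Matrix.vecMulLinear (α : Matrix D ι F[X]) ∘ₗ
      (Finsupp.linearEquivFunOnFinite F[X] F[X] D).toLinearMap)
    (by simpa using hinj)
  simpa [D, pow_two] using this

end CoordTensor
end

/-! ### Existence and positivity of the values -/

noncomputable section

namespace CoordTensor

open Filter Topology

variable {F : Type*} [Field F] {ι κ μ ι' κ' μ' : Type*}
  [Fintype ι] [Fintype κ] [Fintype μ] [Fintype ι'] [Fintype κ'] [Fintype μ']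

theorem finite_pairs (t : CoordTensor F ι κ μ) : (pairs t).Finite := by
  refine ((Set.finite_Iic (Fintype.card ι)).prod (Set.finite_Iic (Fintype.card ι))).subset ?_
  intro p hp
  have h := mul_sq_le_card_of_mem_pairs hp
  have h1 := hp.1
  have h2 := hp.2.1
  have : p.1 ≤ p.1 * p.2 ^ 2 := Nat.le_mul_of_pos_right _ (by positivity)
  have : p.2 ≤ p.1 * p.2 ^ 2 := by nlinarith [Nat.mul_le_mul h1 (le_refl (p.2 ^ 2))]
  exact ⟨by simp only [Set.mem_Iic]; omega, by simp only [Set.mem_Iic]; omega⟩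

/-- The maximum of `log (e m ^ ρ)` over the pairs `(e, m)` in `pairs t`. -/
def logMax (ρ : ℝ) (t : CoordTensor F ι κ μ) : ℝ :=
  sSup ((fun p : ℕ × ℕ => Real.log p.1 + ρ * Real.log p.2) '' pairs t)

theorem isGreatest_logMax (ρ : ℝ) {t : CoordTensor F ι κ μ} (ht : t ≠ 0) :
    IsGreatest ((fun p : ℕ × ℕ => Real.log p.1 + ρ * Real.log p.2) '' pairs t) (logMax ρ t) :=
  ((finite_pairs t).image _).isCompact.isGreatest_sSup (Set.Nonempty.image _ ⟨_, one_mem_pairs ht⟩)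

theorem le_logMax (ρ : ℝ) {t : CoordTensor F ι κ μ} {p : ℕ × ℕ} (hp : p ∈ pairs t) :
    Real.log p.1 + ρ * Real.log p.2 ≤ logMax ρ t :=
  le_csSup ((finite_pairs t).image _).bddAbove ⟨p, hp, rfl⟩

theorem exists_eq_logMax (ρ : ℝ) {t : CoordTensor F ι κ μ} (ht : t ≠ 0) :
    ∃ p ∈ pairs t, Real.log p.1 + ρ * Real.log p.2 = logMax ρ t :=
  (isGreatest_logMax ρ ht).1

theorem logMax_nonneg (ρ : ℝ) {t : CoordTensor F ι κ μ} (ht : t ≠ 0) : 0 ≤ logMax ρ t := by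
  simpa using le_logMax ρ (one_mem_pairs ht)

/-- The flattening bound gives log e + 2 log m ≤ log |ι|, and ρ ≤ 4 would suffice for the factor 2.
Only linear growth along tensor powers matters. -/
theorem logMax_le {ρ : ℝ} (hρ : ρ ≤ 3) {t : CoordTensor F ι κ μ} (ht : t ≠ 0) :
    logMax ρ t ≤ 2 * Real.log (Fintype.card ι) := by
  obtain ⟨p, hp, h⟩ := exists_eq_logMax ρ ht
  rw [← h]
  have h1 : (1 : ℝ) ≤ p.1 := by exact_mod_cast hp.1
  have h2 : (1 : ℝ) ≤ p.2 := by exact_mod_cast hp.2.1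
  have h3 : (p.1 : ℝ) * (p.2 : ℝ) ^ 2 ≤ Fintype.card ι := by
    exact_mod_cast mul_sq_le_card_of_mem_pairs hp
  have h4 := Real.log_le_log (by positivity) h3
  rw [Real.log_mul (by positivity) (by positivity), Real.log_pow] at h4
  push_cast at h4
  nlinarith [Real.log_nonneg h1, Real.log_nonneg h2]

theorem logMax_mono (ρ : ℝ) {t : CoordTensor F ι κ μ} {t' : CoordTensor F ι' κ' μ'}
    (ht : t ≠ 0) (h : IsRestriction t t') : logMax ρ t ≤ logMax ρ t' := by
  obtain ⟨p, hp, h'⟩ := exists_eq_logMax ρ ht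
  rw [← h']
  exact le_logMax ρ (pairs_mono h hp)

/-- The cyclic symmetrization `t ⊗ t_C ⊗ t_{C²}`. -/
def tri (t : CoordTensor F ι κ μ) : CoordTensor F ((ι × κ) × μ) ((κ × μ) × ι) ((μ × ι) × κ) :=
  prod (prod t (cyc t)) (cyc (cyc t))

omit [Fintype ι] [Fintype κ] [Fintype μ] in
theorem exists_ne_zero_of_ne {t : CoordTensor F ι κ μ} (ht : t ≠ 0) : ∃ i j k, t i j k ≠ 0 := by
  by_contra! h
  exact ht (by ext i j k; simp [h])

omit [Fintype ι] [Fintype κ] [Fintype μ] in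
theorem tri_ne_zero {t : CoordTensor F ι κ μ} (ht : t ≠ 0) : tri t ≠ 0 := by
  obtain ⟨i, j, k, h⟩ := exists_ne_zero_of_ne ht
  intro h0
  have := congrFun (congrFun (congrFun h0 ((i, j), k)) ((j, k), i)) ((k, i), j)
  simp [tri, prod, cyc, h] at this

omit [Fintype ι] [Fintype κ] [Fintype μ] in
theorem power_ne_zero {t : CoordTensor F ι κ μ} (ht : t ≠ 0) (N : ℕ) : power t N ≠ 0 := by
  obtain ⟨i, j, k, h⟩ := exists_ne_zero_of_ne ht
  intro h0
  have := congrFun (congrFun (congrFun h0 (fun _ => i)) (fun _ => j)) (fun _ => k)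
  rw [power, Pi.zero_apply, Pi.zero_apply, Pi.zero_apply, Finset.prod_const] at this
  exact pow_ne_zero _ h this

theorem isRestriction_power_add (t : CoordTensor F ι κ μ) (M N : ℕ) :
    IsRestriction (piProd fun b : Bool => power t (bif b then M else N)) (power t (M + N)) := by
  let e : Fin (M + N) ≃ Σ b : Bool, Fin (bif b then M else N) :=
    Fintype.equivOfCardEq (by simp)
  refine IsRestriction.of_comap (fun i l => i (e l).1 (e l).2) (fun i l => i (e l).1 (e l).2)
    (fun i l => i (e l).1 (e l).2) fun i j k => ?_
  rw [power, e.prod_comp fun p => t (i p.1 p.2) (j p.1 p.2) (k p.1 p.2), Fintype.prod_sigma]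
  rfl

/-- Optimal pairs for the factors multiply to an admissible pair for the product, and logarithms
turn this into superadditivity. -/
theorem logMax_piProd_le {L : Type*} [Fintype L] [DecidableEq L] {ι κ μ : L → Type*}
    [∀ l, Fintype (ι l)] [∀ l, Fintype (κ l)] [∀ l, Fintype (μ l)] (ρ : ℝ)
    {A : ∀ l, CoordTensor F (ι l) (κ l) (μ l)} (hA : ∀ l, A l ≠ 0) :
    ∑ l, logMax ρ (A l) ≤ logMax ρ (piProd A) := by
  choose p hp h using fun l => exists_eq_logMax ρ (hA l)
  refine le_trans (le_of_eq ?_) (le_logMax ρ (prod_mem_pairs_piProd hp))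
  simp only [← h]
  push_cast
  rw [Finset.sum_add_distrib, ← Finset.mul_sum,
    Real.log_prod fun l _ => by simpa using (hp l).1.ne',
    Real.log_prod fun l _ => by simpa using (hp l).2.1.ne']

theorem logMax_power_add_le (ρ : ℝ) {t : CoordTensor F ι κ μ} (ht : t ≠ 0) (M N : ℕ) :
    logMax ρ (power t M) + logMax ρ (power t N) ≤ logMax ρ (power t (M + N)) := by
  have h := logMax_piProd_le ρ (A := fun b : Bool => power t (bif b then M else N))
    fun b => power_ne_zero ht _
  rw [Fintype.sum_bool] at h
  refine h.trans (logMax_mono ρ ?_ (isRestriction_power_add t M N))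
  obtain ⟨i, j, k, h⟩ := exists_ne_zero_of_ne ht
  intro h0
  have := congrFun (congrFun (congrFun h0 (fun _ _ => i)) (fun _ _ => j)) (fun _ _ => k)
  simp [piProd, power, h] at this

theorem valueSet_eq (ρ : ℝ) {N : ℕ} (t : CoordTensor F ι κ μ) :
    valueSet ρ N t = (fun x => Real.exp (x / (3 * N))) ''
      ((fun p : ℕ × ℕ => Real.log p.1 + ρ * Real.log p.2) '' pairs (power (tri t) N)) := by
  rw [Set.image_image]
  refine Set.image_congr fun p hp => ?_
  have h1 : (0 : ℝ) < p.1 := by exact_mod_cast hp.1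
  have h2 : (0 : ℝ) < p.2 := by exact_mod_cast hp.2.1
  rw [Real.rpow_def_of_pos (by positivity), Real.log_mul (by positivity) (by positivity),
    Real.log_rpow h2, mul_one_div]

theorem isGreatest_valueSet (ρ : ℝ) (N : ℕ) {t : CoordTensor F ι κ μ} (ht : t ≠ 0) :
    IsGreatest (valueSet ρ N t) (Real.exp (logMax ρ (power (tri t) N) / (3 * N))) := by
  rw [valueSet_eq]
  refine Monotone.map_isGreatest (fun x y hxy => ?_)
    (isGreatest_logMax ρ (power_ne_zero (tri_ne_zero ht) N))
  exact Real.exp_le_exp.2 (by gcongr)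

theorem valueN_eq (ρ : ℝ) (N : ℕ) {t : CoordTensor F ι κ μ} (ht : t ≠ 0) :
    valueN ρ N t = Real.exp (logMax ρ (power (tri t) N) / (3 * N)) :=
  (isGreatest_valueSet ρ N ht).csSup_eq

/-- Fekete's lemma for the negative of `logMax` along powers. The limit is also the supremum, which
yields the bound at every finite N. -/
theorem exists_tendsto_logMax_power {ρ : ℝ} (hρ : ρ ≤ 3) {t : CoordTensor F ι κ μ} (ht : t ≠ 0) :
    ∃ v : ℝ, Tendsto (fun N : ℕ => logMax ρ (power t N) / N) atTop (𝓝 v) ∧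
      ∀ N : ℕ, logMax ρ (power t N) ≤ N * v := by
  have hsub : Subadditive fun N => -logMax ρ (power t N) := fun M N => by
    have := logMax_power_add_le ρ ht M N
    linarith
  have hle : ∀ N : ℕ, logMax ρ (power t N) ≤ N * (2 * Real.log (Fintype.card ι)) := fun N => by
    refine (logMax_le hρ (power_ne_zero ht N)).trans (le_of_eq ?_)
    simp
    ring
  have hb : BddBelow (Set.range fun N : ℕ => -logMax ρ (power t N) / N) := by
    refine ⟨-(2 * Real.log (Fintype.card ι)), ?_⟩
    rintro _ ⟨N, rfl⟩
    rcases N.eq_zero_or_pos with rfl | hN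
    · simp only [Nat.cast_zero, div_zero, Left.neg_nonpos_iff]
      have := Real.log_natCast_nonneg (Fintype.card ι)
      positivity
    · have : (0 : ℝ) < N := by exact_mod_cast hN
      simp only
      rw [le_div_iff₀ this]
      nlinarith [hle N]
  refine ⟨-hsub.lim, ?_, fun N => ?_⟩
  · have := (hsub.tendsto_lim hb).neg
    simpa [neg_div] using this
  · rcases N.eq_zero_or_pos with rfl | hN
    · simpa using hle 0
    · have h1 := hsub.lim_le_div hb hN.ne'
      have : (0 : ℝ) < N := by exact_mod_cast hN
      rw [le_div_iff₀ this] at h1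
      linarith

theorem tendsto_valueN {ρ : ℝ} (hρ : ρ ≤ 3) {t : CoordTensor F ι κ μ} (ht : t ≠ 0) :
    ValueWellDefined ρ t ∧
      Tendsto (fun N : ℕ => logMax ρ (power (tri t) N) / N) atTop
        (𝓝 (3 * Real.log (value ρ t))) ∧
      ∀ N : ℕ, logMax ρ (power (tri t) N) ≤ N * (3 * Real.log (value ρ t)) := by
  obtain ⟨v, hv, hle⟩ := exists_tendsto_logMax_power hρ (tri_ne_zero ht)
  have h1 : Tendsto (fun N : ℕ => valueN ρ N t) atTop (𝓝 (Real.exp (v / 3))) := by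
    refine Tendsto.congr (fun N => ?_) ((Real.continuous_exp.tendsto _).comp (hv.div_const 3))
    rw [valueN_eq ρ N ht, Function.comp, div_div, mul_comm (N : ℝ)]
  have h2 : value ρ t = Real.exp (v / 3) := h1.limUnder_eq
  have h3 : 3 * Real.log (value ρ t) = v := by rw [h2, Real.log_exp]; ring
  rw [h3]
  refine ⟨⟨fun N _ => ?_, h2 ▸ h1, h2 ▸ Real.exp_pos _⟩, hv, hle⟩
  rw [valueN_eq ρ N ht]
  exact isGreatest_valueSet ρ N ht

end CoordTensor
end

/-! ### Coordinates adapted to a decomposition -/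

noncomputable section

open CoordTensor

section Decomposition

variable {F : Type*} [Field F] {U V W : Type*}
  [AddCommGroup U] [Module F U] [AddCommGroup V] [Module F V] [AddCommGroup W] [Module F W]

/-- The contraction of a trilinear form with three functionals. -/
def contract (f : U →ₗ[F] F) (g : V →ₗ[F] F) (h : W →ₗ[F] F) : (U ⊗[F] V) ⊗[F] W →ₗ[F] F :=
  LinearMap.mul' F F ∘ₗ TensorProduct.map (LinearMap.mul' F F ∘ₗ TensorProduct.map f g) h

theorem contract_tmul (f : U →ₗ[F] F) (g : V →ₗ[F] F) (h : W →ₗ[F] F) (u : U) (v : V) (w : W) :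
    contract f g h ((u ⊗ₜ v) ⊗ₜ w) = f u * g v * h w := rfl

theorem contract_map {U' V' W' : Type*} [AddCommGroup U'] [Module F U'] [AddCommGroup V']
    [Module F V'] [AddCommGroup W'] [Module F W'] (f : U →ₗ[F] F) (g : V →ₗ[F] F) (h : W →ₗ[F] F)
    (a : U' →ₗ[F] U) (b : V' →ₗ[F] V) (c : W' →ₗ[F] W) (t : (U' ⊗[F] V') ⊗[F] W') :
    contract f g h (TensorProduct.map (TensorProduct.map a b) c t) =
      contract (f ∘ₗ a) (g ∘ₗ b) (h ∘ₗ c) t := by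
  rw [← LinearMap.comp_apply]
  congr 1
  refine TensorProduct.ext_threefold fun u v w => ?_
  simp [contract_tmul]

theorem contract_eq_sum {ι κ μ : Type*} [Fintype ι] [Fintype κ] [Fintype μ]
    (bU : Module.Basis ι F U) (bV : Module.Basis κ F V) (bW : Module.Basis μ F W)
    (f : U →ₗ[F] F) (g : V →ₗ[F] F) (h : W →ₗ[F] F) (t : (U ⊗[F] V) ⊗[F] W) :
    contract f g h t = ∑ i, ∑ j, ∑ k, tensorCoeffs bU bV bW t i j k *
      (f (bU i) * g (bV j) * h (bW k)) := by
  conv_lhs => rw [← ((bU.tensorProduct bV).tensorProduct bW).sum_repr t]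
  simp only [map_sum, map_smul, Fintype.sum_prod_type, tensorCoeffs,
    Module.Basis.tensorProduct_apply, contract_tmul, smul_eq_mul]

theorem tensorCoeffs_eq_contract {ι κ μ : Type*}
    (bU : Module.Basis ι F U) (bV : Module.Basis κ F V) (bW : Module.Basis μ F W)
    (t : (U ⊗[F] V) ⊗[F] W) (i : ι) (j : κ) (k : μ) :
    tensorCoeffs bU bV bW t i j k = contract (bU.coord i) (bV.coord j) (bW.coord k) t := by
  have : (Finsupp.lapply ((i, j), k)) ∘ₗ
      ((bU.tensorProduct bV).tensorProduct bW).repr.toLinearMap =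
      contract (bU.coord i) (bV.coord j) (bW.coord k) := by
    refine TensorProduct.ext_threefold fun u v w => ?_
    simp [contract_tmul, mul_assoc, mul_comm]
  exact LinearMap.congr_fun this t

variable [FiniteDimensional F U] [FiniteDimensional F V] [FiniteDimensional F W]

theorem tensorCoords_ne_zero {t : (U ⊗[F] V) ⊗[F] W} (ht : t ≠ 0) : tensorCoords t ≠ 0 := by
  intro h
  apply ht
  rw [← (((Module.finBasis F U).tensorProduct (Module.finBasis F V)).tensorProduct
    (Module.finBasis F W)).repr.map_eq_zero_iff]
  ext ⟨⟨i, j⟩, k⟩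
  exact congrFun (congrFun (congrFun h i) j) k

end Decomposition

/-- The projection to a summand of an internal direct sum. -/
def DirectSum.IsInternal.proj {F : Type*} [Field F] {U : Type*} [AddCommGroup U] [Module F U]
    {A : ℤ → Submodule F U} (h : DirectSum.IsInternal A) (i : ℤ) : U →ₗ[F] A i :=
  DirectSum.component F ℤ (fun i => A i) i ∘ₗ
    (LinearEquiv.ofBijective (DirectSum.coeLinearMap A) h).symm.toLinearMap

theorem DirectSum.IsInternal.proj_comp_subtype {F : Type*} [Field F] {U : Type*} [AddCommGroup U]
    [Module F U] {A : ℤ → Submodule F U} (h : DirectSum.IsInternal A) (i : ℤ) :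
    h.proj i ∘ₗ (A i).subtype = LinearMap.id := by
  ext x
  have : (LinearEquiv.ofBijective (DirectSum.coeLinearMap A) h).symm x =
      DirectSum.lof F ℤ (fun i => A i) i x := by
    rw [LinearEquiv.symm_apply_eq]
    exact (DirectSum.coeLinearMap_lof A i x).symm
  simp [DirectSum.IsInternal.proj, this, DirectSum.component.lof_self]

theorem DirectSum.IsInternal.proj_comp_subtype_of_ne {F : Type*} [Field F] {U : Type*}
    [AddCommGroup U] [Module F U] {A : ℤ → Submodule F U} (h : DirectSum.IsInternal A) {i j : ℤ}
    (hij : j ≠ i) : h.proj i ∘ₗ (A j).subtype = 0 := by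
  ext x
  have : (LinearEquiv.ofBijective (DirectSum.coeLinearMap A) h).symm x =
      DirectSum.lof F ℤ (fun i => A i) j x := by
    rw [LinearEquiv.symm_apply_eq]
    exact (DirectSum.coeLinearMap_lof A j x).symm
  simp [DirectSum.IsInternal.proj, this, DirectSum.component.of, hij]

namespace TensorDecomposition

variable {F : Type*} [Field F] {U V W : Type*}
  [AddCommGroup U] [Module F U] [AddCommGroup V] [Module F V] [AddCommGroup W] [Module F W]
  {t : (U ⊗[F] V) ⊗[F] W} (D : TensorDecomposition t)

/-- Functionals that factor through the projections to the summands of s kill every other component,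
so they read off coefficients of t(s) directly from t. -/
theorem contract_proj_comp_subtype (s s' : ℤ × ℤ × ℤ) (f : D.subU s.1 →ₗ[F] F)
    (g : D.subV s.2.1 →ₗ[F] F) (h : D.subW s.2.2 →ₗ[F] F) :
    contract (f ∘ₗ D.isInternal_subU.proj s.1) (g ∘ₗ D.isInternal_subV.proj s.2.1)
      (h ∘ₗ D.isInternal_subW.proj s.2.2) (TensorProduct.map
        (TensorProduct.map (D.subU s'.1).subtype (D.subV s'.2.1).subtype)
        (D.subW s'.2.2).subtype (D.comp s')) =
      if s' = s then contract f g h (D.comp s) else 0 := by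
  rw [contract_map]
  simp only [LinearMap.comp_assoc]
  split_ifs with hs
  · subst hs
    simp only [DirectSum.IsInternal.proj_comp_subtype, LinearMap.comp_id]
  · have : s'.1 ≠ s.1 ∨ s'.2.1 ≠ s.2.1 ∨ s'.2.2 ≠ s.2.2 := by
      by_contra! h
      exact hs (Prod.ext h.1 (Prod.ext h.2.1 h.2.2))
    rcases this with h1 | h1 | h1 <;>
      simp [DirectSum.IsInternal.proj_comp_subtype_of_ne, h1, contract]

variable [FiniteDimensional F U] [FiniteDimensional F V] [FiniteDimensional F W]

/-- The coefficients of `t` with respect to bases adapted to the decomposition. -/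
def coords : CoordTensor F (Σ i : D.I, Fin (Module.finrank F (D.subU i)))
    (Σ j : D.J, Fin (Module.finrank F (D.subV j)))
    (Σ k : D.K, Fin (Module.finrank F (D.subW k))) :=
  fun i j k => tensorCoords (D.comp (i.1, j.1, k.1)) i.2 j.2 k.2

theorem isRestriction_coords : IsRestriction D.coords (tensorCoords t) := by
  refine ⟨fun i p => ((Module.finBasis F (D.subU i.1)).coord i.2 ∘ₗ
      D.isInternal_subU.proj i.1) (Module.finBasis F U p),
    fun i p => ((Module.finBasis F (D.subV i.1)).coord i.2 ∘ₗ
      D.isInternal_subV.proj i.1) (Module.finBasis F V p),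
    fun i p => ((Module.finBasis F (D.subW i.1)).coord i.2 ∘ₗ
      D.isInternal_subW.proj i.1) (Module.finBasis F W p), ?_⟩
  intro i j k
  rw [tensorCoords, ← contract_eq_sum, coords, tensorCoords, tensorCoeffs_eq_contract]
  have h := congrArg (contract ((Module.finBasis F (D.subU i.1)).coord i.2 ∘ₗ
      D.isInternal_subU.proj i.1) ((Module.finBasis F (D.subV j.1)).coord j.2 ∘ₗ
      D.isInternal_subV.proj j.1) ((Module.finBasis F (D.subW k.1)).coord k.2 ∘ₗ
      D.isInternal_subW.proj k.1)) D.sum_comp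
  rw [map_sum, Finset.sum_congr rfl fun s' _ => D.contract_proj_comp_subtype
    ((i.1 : ℤ), (j.1 : ℤ), (k.1 : ℤ)) s' _ _ _, Finset.sum_ite_eq', if_pos] at h
  · exact h
  · simp

theorem mem_supp_of_coords_ne_zero {i j k} (h : D.coords i j k ≠ 0) :
    ((i.1 : ℤ), (j.1 : ℤ), (k.1 : ℤ)) ∈ D.supp := by
  classical
  rw [supp, Finset.mem_filter]
  refine ⟨by simp, fun h0 => h ?_⟩
  rw [coords, h0]
  simp [tensorCoords, tensorCoeffs]

theorem isRestriction_comp {s : ℤ × ℤ × ℤ} (hs : s ∈ D.supp) :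
    IsRestriction (tensorCoords (D.comp s))
      (fun i j k => if ((i.1 : ℤ), (j.1 : ℤ), (k.1 : ℤ)) = s then D.coords i j k else 0) := by
  classical
  rw [supp, Finset.mem_filter, Finset.mem_product, Finset.mem_product] at hs
  exact IsRestriction.of_comap (fun a => ⟨⟨s.1, hs.1.1⟩, a⟩) (fun a => ⟨⟨s.2.1, hs.1.2.1⟩, a⟩)
    (fun a => ⟨⟨s.2.2, hs.1.2.2⟩, a⟩) fun i j k => by simp [coords]

omit [FiniteDimensional F U] [FiniteDimensional F V] [FiniteDimensional F W] in
theorem comp_ne_zero {s : ℤ × ℤ × ℤ} (hs : s ∈ D.supp) : D.comp s ≠ 0 := by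
  classical
  rw [supp, Finset.mem_filter] at hs
  exact hs.2

theorem coords_ne_zero {s : ℤ × ℤ × ℤ} (hs : s ∈ D.supp) : D.coords ≠ 0 := by
  have h1 := (D.isRestriction_comp hs).ne_zero (tensorCoords_ne_zero (D.comp_ne_zero hs))
  intro h
  exact h1 (by simp [h]; rfl)

end TensorDecomposition
end

/-! ### Hashing into progression-free sets -/

noncomputable section

section Hashing

variable {n : Type*} [Fintype n] [DecidableEq n] {M : ℕ} [Fact M.Prime]

/-- A hyperplane in `(ℤ/M)^n` has at most `M ^ (n - 1)` elements. -/
theorem card_dotProduct_eq_zero_mul_le {δ : n → ZMod M} (hδ : δ ≠ 0) :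
    Finset.card {w : n → ZMod M | w ⬝ᵥ δ = 0} * M ≤ M ^ Fintype.card n := by
  obtain ⟨k, hk⟩ := Function.ne_iff.1 hδ
  -- The M translates of the hyperplane along the k-th axis are disjoint: the shift by a changes the
  -- product with δ by a δ_k, and δ_k ≠ 0.
  have h := Finset.card_le_card_of_injOn
    (s := ({w : n → ZMod M | w ⬝ᵥ δ = 0} : Finset _) ×ˢ (Finset.univ : Finset (ZMod M)))
    (t := (Finset.univ : Finset (n → ZMod M))) (fun p => p.1 + Pi.single k p.2)
    (fun _ _ => Finset.mem_coe.2 (Finset.mem_univ _)) ?_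
  · simpa [Finset.card_product, ZMod.card] using h
  · rintro ⟨w, a⟩ hw ⟨w', a'⟩ hw' heq
    simp only [Finset.coe_product, Set.mem_prod, Finset.mem_coe, Finset.mem_filter,
      Finset.mem_univ, true_and, and_true] at hw hw'
    have h1 := congrArg (· ⬝ᵥ δ) heq
    simp only [add_dotProduct, hw, hw', single_dotProduct, zero_add] at h1
    have h2 : a = a' := mul_right_cancel₀ hk h1
    subst h2
    have h3 : w = w' := add_right_cancel heq
    rw [h3]

/-- The triples `(w, u, v)` of hash parameters for which `x` and `y` are both hashed to `b`. -/
def hashHits (x y : n → ZMod M) (b : ZMod M) :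
    Finset ((n → ZMod M) × ZMod M × ZMod M) :=
  {θ | θ.1 ⬝ᵥ x + θ.2.1 = b ∧ θ.1 ⬝ᵥ y + θ.2.2 = b}

theorem card_hashHits (x y : n → ZMod M) (b : ZMod M) :
    M ^ Fintype.card n ≤ (hashHits x y b).card := by
  have h := Finset.card_le_card_of_injOn (s := (Finset.univ : Finset (n → ZMod M)))
    (t := hashHits x y b) (fun w => (w, b - w ⬝ᵥ x, b - w ⬝ᵥ y))
    (fun w _ => by simp [hashHits]) (fun w _ w' _ h => (Prod.ext_iff.1 h).1)
  simpa [ZMod.card] using h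

/-- Two simultaneous hits force w to be orthogonal to x − x' and y − y', one of which is nonzero; u
and v are then determined by w. This is pairwise independence of the hash. -/
theorem card_hashHits_inter_le {x y x' y' : n → ZMod M} (b : ZMod M) (h : x ≠ x' ∨ y ≠ y') :
    (hashHits x y b ∩ hashHits x' y' b).card * M ≤ M ^ Fintype.card n := by
  have key : ∀ δ : n → ZMod M, (δ = x - x' ∨ δ = y - y') →
      (hashHits x y b ∩ hashHits x' y' b).card ≤
        Finset.card {w : n → ZMod M | w ⬝ᵥ δ = 0} := by
    intro δ hδ
    refine Finset.card_le_card_of_injOn Prod.fst ?_ ?_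
    · rintro ⟨w, u, v⟩ hw
      simp only [hashHits, Finset.coe_inter, Set.mem_inter_iff, Finset.mem_coe,
        Finset.mem_filter, Finset.mem_univ, true_and] at hw ⊢
      obtain ⟨⟨h1, h2⟩, h3, h4⟩ := hw
      rcases hδ with rfl | rfl
      · rw [dotProduct_sub]; linear_combination h1 - h3
      · rw [dotProduct_sub]; linear_combination h2 - h4
    · rintro ⟨w, u, v⟩ hw ⟨w', u', v'⟩ hw' (rfl : w = w')
      simp only [hashHits, Finset.coe_inter, Set.mem_inter_iff, Finset.mem_coe,
        Finset.mem_filter, Finset.mem_univ, true_and] at hw hw'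
      have h1 : u = u' := by linear_combination hw.1.1 - hw'.1.1
      have h2 : v = v' := by linear_combination hw.1.2 - hw'.1.2
      rw [h1, h2]
  rcases h with h | h
  · exact (Nat.mul_le_mul_right _ (key _ (.inl rfl))).trans
      (card_dotProduct_eq_zero_mul_le (sub_ne_zero.2 h))
  · exact (Nat.mul_le_mul_right _ (key _ (.inr rfl))).trans
      (card_dotProduct_eq_zero_mul_le (sub_ne_zero.2 h))

theorem natCast_zmod_inj_of_lt {a b : ℕ} (ha : a < M) (hb : b < M)
    (h : (a : ZMod M) = b) : a = b := by
  rw [ZMod.natCast_eq_natCast_iff'] at h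
  rwa [Nat.mod_eq_of_lt ha, Nat.mod_eq_of_lt hb] at h

variable {τ : Type*} [DecidableEq τ]

/-- The hashing step of the laser method: in a tight set `Ω` of triples in which every coordinate
lies on at most `R` triples, a set `G ⊆ Ω` contains a large subset of triples that do not
interact in `Ω`. -/
theorem exists_isolated_subset (x y z : τ → n → ZMod M) (Ω G : Finset τ) (hG : G ⊆ Ω)
    (c : n → ZMod M) (hc : ∀ ω ∈ Ω, x ω + y ω + z ω = c)
    (hinj : ∀ ω ∈ Ω, ∀ ω' ∈ Ω, x ω = x ω' → y ω = y ω' → ω = ω') (R : ℕ)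
    (hx : ∀ g ∈ G, Finset.card {ω ∈ Ω | x ω = x g} ≤ R)
    (hy : ∀ g ∈ G, Finset.card {ω ∈ Ω | y ω = y g} ≤ R)
    (hz : ∀ g ∈ G, Finset.card {ω ∈ Ω | z ω = z g} ≤ R)
    (B : Finset ℕ) (hB : ThreeAPFree (B : Set ℕ)) (hBM : B ⊆ Finset.range ((M + 1) / 2)) :
    ∃ G' ⊆ G, (G.card : ℝ) * B.card * (M - 3 * R) ≤ G'.card * (M : ℝ) ^ 3 ∧
      ∀ ω ∈ Ω, ∀ g₁ ∈ G', ∀ g₂ ∈ G', ∀ g₃ ∈ G', x ω = x g₁ → y ω = y g₂ → z ω = z g₃ →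
        ω = g₁ ∧ ω = g₂ ∧ ω = g₃ := by
  have hM0 : 0 < M := (Fact.out : M.Prime).pos
  have hM1 : 1 < M := (Fact.out : M.Prime).one_lt
  have hBlt : ∀ b ∈ B, 2 * b < M := fun b hb => by
    have := Finset.mem_range.1 (hBM hb)
    omega
  let share : τ → Finset τ := fun g => {ω ∈ Ω | ω ≠ g ∧ (x ω = x g ∨ y ω = y g ∨ z ω = z g)}
  have hshare : ∀ g ∈ G, (share g).card ≤ 3 * R := by
    intro g hg
    have : share g ⊆ {ω ∈ Ω | x ω = x g} ∪ {ω ∈ Ω | y ω = y g} ∪ {ω ∈ Ω | z ω = z g} := by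
      intro ω hω
      simp only [share, Finset.mem_filter, Finset.mem_union] at hω ⊢
      tauto
    refine (Finset.card_le_card this).trans ((Finset.card_union_le _ _).trans ?_)
    have := Finset.card_union_le {ω ∈ Ω | x ω = x g} {ω ∈ Ω | y ω = y g}
    have := hx g hg
    have := hy g hg
    have := hz g hg
    omega
  let Θ := (n → ZMod M) × ZMod M × ZMod M
  let hit : τ → ℕ → Finset Θ := fun g b => hashHits (x g) (y g) (b : ZMod M)
  let A : Θ → Finset (τ × ℕ) := fun θ => {p ∈ G ×ˢ B | θ ∈ hit p.1 p.2}
  let C : Θ → Finset ((_ : τ) × τ × ℕ) := fun θ =>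
    {p ∈ G.sigma fun g => share g ×ˢ B | θ ∈ hit p.1 p.2.2 ∩ hit p.2.1 p.2.2}
  have hA : G.card * B.card * M ^ Fintype.card n ≤ ∑ θ, (A θ).card := by
    have : ∑ θ, (A θ).card = ∑ p ∈ G ×ˢ B, (hit p.1 p.2).card := by
      simp only [A, Finset.card_filter]
      rw [Finset.sum_comm]
      refine Finset.sum_congr rfl fun p _ => ?_
      rw [← Finset.card_filter, Finset.filter_univ_mem]
    rw [this, ← Finset.card_product, ← smul_eq_mul]
    exact Finset.card_nsmul_le_sum _ _ _ fun p _ => card_hashHits _ _ _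
  have hC : (∑ θ, (C θ).card) * M ≤ G.card * (3 * R * B.card) * M ^ Fintype.card n := by
    have : ∑ θ, (C θ).card = ∑ p ∈ G.sigma fun g => share g ×ˢ B,
        (hit p.1 p.2.2 ∩ hit p.2.1 p.2.2).card := by
      simp only [C, Finset.card_filter]
      rw [Finset.sum_comm]
      refine Finset.sum_congr rfl fun p _ => ?_
      rw [← Finset.card_filter, Finset.filter_univ_mem]
    rw [this, Finset.sum_mul]
    refine (Finset.sum_le_card_nsmul _ _ (M ^ Fintype.card n) ?_).trans ?_
    · rintro ⟨g, ω, b⟩ hp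
      simp only [Finset.mem_sigma, Finset.mem_product, share, Finset.mem_filter] at hp
      refine card_hashHits_inter_le _ ?_
      by_contra! h
      exact hp.2.1.2.1 (hinj _ hp.2.1.1 _ (hG hp.1) h.1.symm h.2.symm)
    · rw [smul_eq_mul]
      refine Nat.mul_le_mul_right _ ?_
      rw [Finset.card_sigma, ← smul_eq_mul]
      refine Finset.sum_le_card_nsmul _ _ _ fun g hg => ?_
      rw [Finset.card_product]
      exact Nat.mul_le_mul_right _ (hshare g hg)
  have hΘ : Fintype.card Θ = M ^ Fintype.card n * M ^ 2 := by
    simp only [Θ, Fintype.card_prod, Fintype.card_fun, ZMod.card]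
    ring
  -- First moment over the M^(n+2) hash parameters: the hits number at least |G||B|M^n and the
  -- conflicts at most 3R|G||B|M^(n-1) in total, so some parameter has at least the average surplus.
  obtain ⟨θ, -, hθ⟩ : ∃ θ ∈ (Finset.univ : Finset Θ), (G.card : ℝ) * B.card * (M - 3 * R) ≤
      (((A θ).card : ℝ) - (C θ).card) * (M : ℝ) ^ 3 := by
    refine Finset.exists_le_of_sum_le Finset.univ_nonempty ?_
    rw [Finset.sum_const, Finset.card_univ, hΘ, nsmul_eq_mul, ← Finset.sum_mul,
      Finset.sum_sub_distrib]
    have hA' : (G.card * B.card * M ^ Fintype.card n : ℝ) ≤ ∑ θ, ((A θ).card : ℝ) := by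
      exact_mod_cast hA
    have hC' : (∑ θ, ((C θ).card : ℝ)) * M ≤
        G.card * (3 * R * B.card) * M ^ Fintype.card n := by exact_mod_cast hC
    have hMp : (0 : ℝ) < M := by exact_mod_cast hM0
    push_cast
    have h1 := mul_le_mul_of_nonneg_right hA' (by positivity : (0 : ℝ) ≤ (M : ℝ) ^ 3)
    have h2 := mul_le_mul_of_nonneg_right hC' (by positivity : (0 : ℝ) ≤ (M : ℝ) ^ 2)
    linarith
  have hAinj : Set.InjOn Prod.fst (A θ : Set (τ × ℕ)) := by
    rintro ⟨g, b⟩ h1 ⟨g', b'⟩ h2 (rfl : g = g')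
    simp only [A, Finset.coe_filter, Set.mem_ofPred_eq, Finset.mem_product, hit, hashHits,
      Finset.mem_filter] at h1 h2
    have hbb : (b : ZMod M) = b' := h1.2.2.1.symm.trans h2.2.2.1
    have := hBlt _ h1.1.2
    have := hBlt _ h2.1.2
    rw [natCast_zmod_inj_of_lt (M := M) (by omega) (by omega) hbb]
  -- Keep the hashed triples and delete every one that shares a coordinate with another triple of Ω
  -- hashed to the same value.
  refine ⟨(A θ).image Prod.fst \ (C θ).image Sigma.fst, ?_, ?_, ?_⟩
  · intro g hg
    obtain ⟨p, hp, rfl⟩ := Finset.mem_image.1 (Finset.mem_sdiff.1 hg).1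
    exact (Finset.mem_product.1 (Finset.mem_filter.1 hp).1).1
  · refine hθ.trans (mul_le_mul_of_nonneg_right ?_ (by positivity))
    have h1 := Finset.le_card_sdiff ((C θ).image Sigma.fst) ((A θ).image Prod.fst)
    rw [Finset.card_image_of_injOn hAinj] at h1
    have h2 : ((C θ).image Sigma.fst).card ≤ (C θ).card := Finset.card_image_le
    have h3 : (A θ).card ≤ ((A θ).image Prod.fst \ (C θ).image Sigma.fst).card + (C θ).card := by
      omega
    have h4 : ((A θ).card : ℝ) ≤
        ((A θ).image Prod.fst \ (C θ).image Sigma.fst).card + (C θ).card := by exact_mod_cast h3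
    linarith
  · have hmem : ∀ g ∈ (A θ).image Prod.fst \ (C θ).image Sigma.fst, ∃ b ∈ B, g ∈ G ∧
        θ ∈ hit g b ∧ ∀ ω ∈ share g, θ ∉ hit ω b := by
      intro g hg
      obtain ⟨h1, h2⟩ := Finset.mem_sdiff.1 hg
      obtain ⟨⟨g', b⟩, hp, rfl⟩ := Finset.mem_image.1 h1
      simp only [A, Finset.mem_filter, Finset.mem_product] at hp
      refine ⟨b, hp.1.2, hp.1.1, hp.2, fun ω hω hit' => h2 ?_⟩
      refine Finset.mem_image.2 ⟨⟨g', ω, b⟩, ?_, rfl⟩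
      simp only [C, Finset.mem_filter, Finset.mem_sigma, Finset.mem_product, Finset.mem_inter]
      exact ⟨⟨hp.1.1, hω, hp.1.2⟩, hp.2, hit'⟩
    intro ω hω g₁ hg₁ g₂ hg₂ g₃ hg₃ e1 e2 e3
    obtain ⟨b₁, hb₁, hG₁, hh₁, hs₁⟩ := hmem g₁ hg₁
    obtain ⟨b₂, hb₂, hG₂, hh₂, hs₂⟩ := hmem g₂ hg₂
    obtain ⟨b₃, hb₃, hG₃, hh₃, hs₃⟩ := hmem g₃ hg₃
    obtain ⟨w, u, v⟩ := θ
    simp only [hit, hashHits, Finset.mem_filter, Finset.mem_univ, true_and] at hh₁ hh₂ hh₃ hs₁ hs₂ hs₃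
    have d1 := congrArg (w ⬝ᵥ ·) (hc ω hω)
    have d3 := congrArg (w ⬝ᵥ ·) (hc g₃ (hG hG₃))
    simp only [dotProduct_add, e1, e2, e3] at d1 d3
    -- By tightness the sum of the x-hash and the y-hash depends on z alone. For ω this sum is b₁ +
    -- b₂, for g₃ it is 2b₃, and the two share z. As elements of B lie below M/2, the equation holds
    -- in ℕ and B forces b₁ = b₂ = b₃.
    have hsum : ((b₁ + b₂ : ℕ) : ZMod M) = ((b₃ + b₃ : ℕ) : ZMod M) := by
      push_cast
      linear_combination (-1 : ZMod M) * hh₁.1 - hh₂.2 + hh₃.1 + hh₃.2 + d1 - d3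
    have l1 := hBlt _ hb₁
    have l2 := hBlt _ hb₂
    have l3 := hBlt _ hb₃
    have hsum' := natCast_zmod_inj_of_lt (M := M) (by omega) (by omega) hsum
    have hb13 : b₁ = b₃ := hB hb₁ hb₃ hb₂ hsum'
    have hb23 : b₂ = b₃ := by omega
    subst hb13
    subst hb23
    have hωhit : w ⬝ᵥ x ω + u = b₂ ∧ w ⬝ᵥ y ω + v = b₂ := ⟨e1 ▸ hh₁.1, e2 ▸ hh₂.2⟩
    refine ⟨?_, ?_, ?_⟩
    · by_contra hne
      exact hs₁ ω (Finset.mem_filter.2 ⟨hω, hne, .inl e1⟩) hωhit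
    · by_contra hne
      exact hs₂ ω (Finset.mem_filter.2 ⟨hω, hne, .inr (.inl e2)⟩) hωhit
    · by_contra hne
      exact hs₃ ω (Finset.mem_filter.2 ⟨hω, hne, .inr (.inr e3)⟩) hωhit

end Hashing
end

/-! ### Counting sequences by type, and entropy -/

noncomputable section

open Filter Topology

section Types

theorem le_log_factorial (n : ℕ) : n * Real.log n - n ≤ Real.log n.factorial := by
  rcases n.eq_zero_or_pos with rfl | hn
  · simp
  have hn' : (0 : ℝ) < n := by exact_mod_cast hn
  have h := Real.pow_div_factorial_le_exp (x := (n : ℝ)) hn'.le n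
  have h1 := Real.log_le_log (by positivity) h
  rw [Real.log_exp, Real.log_div (by positivity) (by positivity), Real.log_pow] at h1
  linarith

theorem log_factorial_le {n : ℕ} (hn : 1 ≤ n) :
    Real.log n.factorial ≤ n * Real.log n - n + 1 + Real.log n := by
  induction n, hn using Nat.le_induction with
  | base => simp
  | succ n hn ih =>
    have hn' : (0 : ℝ) < n := by exact_mod_cast hn
    rw [Nat.factorial_succ, Nat.cast_mul, Real.log_mul (by positivity) (by positivity)]
    have h := Real.one_sub_inv_le_log_of_pos (x := ((n + 1 : ℕ) : ℝ) / n) (by positivity)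
    rw [Real.log_div (by positivity) (by positivity)] at h
    have h2 : 1 - (((n + 1 : ℕ) : ℝ) / n)⁻¹ = 1 / (n + 1 : ℕ) := by
      push_cast; field_simp; ring
    rw [h2, div_le_iff₀ (by positivity)] at h
    push_cast at h ih ⊢
    linarith

variable {α : Type*} [Fintype α] [DecidableEq α]

/-- The sequences in which `s` occurs `c s` times. -/
def typeClass (N : ℕ) (c : α → ℕ) : Finset (Fin N → α) :=
  {a | ∀ s, Finset.card {l | a l = s} = c s}

theorem mem_typeClass {N : ℕ} {c : α → ℕ} {a : Fin N → α} :
    a ∈ typeClass N c ↔ ∀ s, Finset.card {l | a l = s} = c s := by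
  simp [typeClass]

theorem sum_comp_eq_of_mem_typeClass {N : ℕ} {c : α → ℕ} {a : Fin N → α}
    (ha : a ∈ typeClass N c) (f : α → ℝ) : ∑ l, f (a l) = ∑ s, c s * f s := by
  rw [mem_typeClass] at ha
  rw [← Finset.sum_fiberwise (s := Finset.univ) (g := a)]
  refine Finset.sum_congr rfl fun s _ => ?_
  rw [← ha s, ← nsmul_eq_mul]
  exact Finset.sum_eq_card_nsmul fun l hl => by rw [(Finset.mem_filter.1 hl).2]

theorem exists_equiv_of_mem_typeClass {N : ℕ} {c : α → ℕ} {a : Fin N → α}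
    (ha : a ∈ typeClass N c) : ∃ e : Fin N ≃ Σ s, Fin (c s), ∀ l, (e l).1 = a l := by
  rw [mem_typeClass] at ha
  have : ∀ s, Nonempty ({l // a l = s} ≃ Fin (c s)) := fun s =>
    ⟨Fintype.equivFinOfCardEq (by rw [Fintype.card_subtype, ha])⟩
  exact ⟨(Equiv.sigmaFiberEquiv a).symm.trans
    (Equiv.sigmaCongrRight fun s => Classical.choice (this s)), fun l => rfl⟩

/-- Permuting the positions of one fixed sequence of type c stays in the class, and each sequence
reached comes from at most as many permutations as the stabilizer contains, namely ∏ (c s)!. -/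
theorem factorial_le_prod_mul_card_typeClass {N : ℕ} {c : α → ℕ} (hc : ∑ s, c s = N) :
    N.factorial ≤ (∏ s, (c s).factorial) * (typeClass N c).card := by
  let e : Fin N ≃ Σ s, Fin (c s) := Fintype.equivOfCardEq (by simp [hc])
  let f : Fin N → α := fun l => (e l).1
  have hf : ∀ s, Fintype.card {l // f l = s} = c s := fun s => by
    have e1 : {l // f l = s} ≃ {p : Σ s, Fin (c s) // p.1 = s} :=
      e.subtypeEquiv fun l => Iff.rfl
    rw [Fintype.card_congr (e1.trans (Equiv.sigmaSubtype s)), Fintype.card_fin]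
  have hcard := Finset.card_le_mul_card_image (f := fun g : Equiv.Perm (Fin N) => f ∘ g)
    Finset.univ (∏ s, (c s).factorial) ?_
  · rw [Finset.card_univ, Fintype.card_perm, Fintype.card_fin] at hcard
    refine hcard.trans (Nat.mul_le_mul_left _ (Finset.card_le_card ?_))
    intro a ha
    obtain ⟨g, -, rfl⟩ := Finset.mem_image.1 ha
    rw [mem_typeClass]
    intro s
    rw [← hf s, ← Fintype.card_subtype]
    exact Fintype.card_congr (g.subtypeEquiv fun l => Iff.rfl)
  · intro a ha
    obtain ⟨g₀, -, rfl⟩ := Finset.mem_image.1 ha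
    have h := DomMulAct.stabilizer_card f
    simp only [hf] at h
    rw [← h, Fintype.card_subtype]
    refine Finset.card_le_card_of_injOn (fun g => g * g₀⁻¹) ?_ fun g _ g' _ hgg =>
      mul_right_cancel hgg
    intro g hg
    simp only [Finset.coe_filter, Finset.mem_univ, true_and, Set.mem_ofPred_eq] at hg ⊢
    ext l
    have := congrFun hg (g₀⁻¹ l)
    simpa using this

theorem typeClass_nonempty {N : ℕ} {c : α → ℕ} (hc : ∑ s, c s = N) :
    (typeClass N c).Nonempty := by
  rw [← Finset.card_pos]
  have h := factorial_le_prod_mul_card_typeClass hc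
  have := N.factorial_pos
  by_contra h0
  simp [Nat.eq_zero_of_not_pos h0] at h
  omega

theorem le_log_card_typeClass {N : ℕ} {c : α → ℕ} (hc : ∑ s, c s = N) :
    N * ∑ s, Real.negMulLog (c s / N) - Fintype.card α * (1 + Real.log (N + 1)) ≤
      Real.log (typeClass N c).card := by
  have h : (N.factorial : ℝ) ≤ (∏ s, ((c s).factorial : ℝ)) * (typeClass N c).card := by
    exact_mod_cast factorial_le_prod_mul_card_typeClass hc
  have hpos : (0 : ℝ) < (typeClass N c).card := by
    exact_mod_cast (typeClass_nonempty hc).card_pos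
  have h1 := Real.log_le_log (by positivity) h
  rw [Real.log_mul (Finset.prod_ne_zero_iff.2 fun s _ => by positivity) hpos.ne',
    Real.log_prod fun s _ => by positivity] at h1
  have h2 := le_log_factorial N
  have h3 : ∀ s, Real.log (c s).factorial ≤
      c s * Real.log (c s) - c s + (1 + Real.log (N + 1)) := fun s => by
    have hN : 0 ≤ Real.log ((N : ℝ) + 1) := Real.log_nonneg (by simp)
    rcases (c s).eq_zero_or_pos with h0 | h0
    · simp [h0]; linarith
    · have hle : c s ≤ N := hc ▸ Finset.single_le_sum (fun _ _ => Nat.zero_le _) (Finset.mem_univ s)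
      have hle' : (c s : ℝ) ≤ N + 1 := by exact_mod_cast hle.trans (Nat.le_succ _)
      have h0' : (0 : ℝ) < c s := by exact_mod_cast h0
      have := log_factorial_le h0
      have := Real.log_le_log h0' hle'
      linarith
  have h4 := Finset.sum_le_sum fun s (_ : s ∈ Finset.univ) => h3 s
  rw [Finset.sum_add_distrib, Finset.sum_sub_distrib, Finset.sum_const, Finset.card_univ,
    nsmul_eq_mul] at h4
  have hc' : ∑ s, (c s : ℝ) = N := by exact_mod_cast hc
  have h5 : N * ∑ s, Real.negMulLog (c s / N) = N * Real.log N - ∑ s, c s * Real.log (c s) := by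
    rcases N.eq_zero_or_pos with rfl | hN
    · have : ∀ s, c s = 0 := by simpa using hc
      simp [this]
    have hN' : (N : ℝ) ≠ 0 := by positivity
    rw [← hc', Finset.mul_sum, Finset.sum_mul, ← Finset.sum_sub_distrib, hc']
    refine Finset.sum_congr rfl fun s _ => ?_
    rcases (c s).eq_zero_or_pos with h0 | h0
    · simp [h0]
    · have h0' : (c s : ℝ) ≠ 0 := by positivity
      rw [Real.negMulLog, Real.log_div h0' hN']
      field_simp
      ring
  rw [h5]
  linarith

/-- Approximation of a distribution by integer counts. -/
theorem exists_counts_tendsto {P : α → ℝ} (hP : P ∈ stdSimplex ℝ α) :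
    ∃ c : ℕ → α → ℕ, (∀ N, ∑ s, c N s = N) ∧
      ∀ s, Tendsto (fun N : ℕ => (c N s : ℝ) / N) atTop (𝓝 (P s)) := by
  have hne : Nonempty α := by
    by_contra h
    rw [not_nonempty_iff] at h
    simpa using hP.2
  let s₀ := Classical.arbitrary α
  have hsum : ∀ N : ℕ, ∑ s, ⌊P s * N⌋₊ ≤ N := fun N => by
    have : ((∑ s, ⌊P s * N⌋₊ : ℕ) : ℝ) ≤ N := by
      push_cast
      calc ∑ s, (⌊P s * N⌋₊ : ℝ) ≤ ∑ s, P s * N := Finset.sum_le_sum fun s _ =>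
            Nat.floor_le (mul_nonneg (hP.1 s) (by positivity))
        _ = N := by rw [← Finset.sum_mul, hP.2, one_mul]
    exact_mod_cast this
  have hfl : ∀ s, Tendsto (fun N : ℕ => (⌊P s * N⌋₊ : ℝ) / N) atTop (𝓝 (P s)) := fun s =>
    (tendsto_nat_floor_mul_div_atTop (hP.1 s)).comp tendsto_natCast_atTop_atTop
  -- Round down and give the whole deficit to one symbol s₀; the deficit is o(N).
  refine ⟨fun N s => ⌊P s * N⌋₊ + if s = s₀ then N - ∑ s, ⌊P s * N⌋₊ else 0, fun N => ?_,
    fun s => ?_⟩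
  · rw [Finset.sum_add_distrib, Finset.sum_ite_eq' Finset.univ s₀, if_pos (Finset.mem_univ _)]
    exact Nat.add_sub_cancel' (hsum N)
  · have h0 : Tendsto (fun N : ℕ => ((N - ∑ s, ⌊P s * N⌋₊ : ℕ) : ℝ) / N) atTop (𝓝 0) := by
      have h1 : Tendsto (fun N : ℕ => 1 - ∑ s, (⌊P s * N⌋₊ : ℝ) / N) atTop (𝓝 (1 - ∑ s, P s)) :=
        tendsto_const_nhds.sub (tendsto_finsetSum _ fun s _ => hfl s)
      rw [hP.2, sub_self] at h1
      refine h1.congr' ?_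
      filter_upwards [eventually_gt_atTop 0] with N hN
      have hN' : (N : ℝ) ≠ 0 := by positivity
      rw [Nat.cast_sub (hsum N), sub_div, div_self hN', ← Finset.sum_div]
      push_cast
      rfl
    by_cases hs : s = s₀
    · rw [hs]
      simpa [add_div] using (hfl s₀).add h0
    · simpa [hs] using hfl s

end Types

section Entropy

variable {S : Finset (ℤ × ℤ × ℤ)}

theorem continuous_marginalFun (l : Fin 3) (a : ℤ) :
    Continuous fun P : S → ℝ => marginalFun l P a := by
  unfold marginalFun
  fun_prop

theorem continuous_entropyOn : Continuous (entropyOn (S := S)) :=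
  continuous_finsetSum _ fun s _ => Real.continuous_negMulLog.comp (continuous_apply s)

theorem continuous_marginalEntropy (l : Fin 3) : Continuous (marginalEntropy (S := S) l) :=
  continuous_finsetSum _ fun a _ => Real.continuous_negMulLog.comp (continuous_marginalFun l a)

/-- The maximal entropy of a compatible distribution is upper semicontinuous. -/
theorem eventually_entropyOn_compatible_le {P : S → ℝ} (hP : P ∈ stdSimplex ℝ S) {ε : ℝ}
    (hε : 0 < ε) : ∀ᶠ P' in 𝓝 P, ∀ Q ∈ compatibleDistributions P',
      entropyOn Q ≤ sSup (entropyOn '' compatibleDistributions P) + ε := by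
  have hmax := (isGreatest_entropyOn_compatible P hP).2
  have h := (isCompact_stdSimplex ℝ S).eventually_forall_of_forall_eventually (x₀ := P)
    (P := fun P' Q => Q ∈ compatibleDistributions P' →
      entropyOn Q ≤ sSup (entropyOn '' compatibleDistributions P) + ε) ?_
  · filter_upwards [h] with P' h Q hQ
    exact h Q hQ.1 hQ
  intro Q hQ
  -- Either the entropy stays below the bound near Q, or Q is not compatible with P; in the latter
  -- case a marginal differs, and continues to differ for nearby pairs. Compactness of the simplex
  -- makes this uniform in Q.
  by_cases hlt : entropyOn Q < sSup (entropyOn '' compatibleDistributions P) + ε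
  · have : ∀ᶠ z : (S → ℝ) × (S → ℝ) in 𝓝 (P, Q),
        entropyOn z.2 < sSup (entropyOn '' compatibleDistributions P) + ε :=
      (continuous_entropyOn.comp continuous_snd).continuousAt.eventually_lt_const hlt
    filter_upwards [this] with z hz _
    exact hz.le
  · have hQP : Q ∉ compatibleDistributions P := fun hQP =>
      hlt ((hmax ⟨Q, hQP, rfl⟩).trans_lt (by linarith))
    simp only [compatibleDistributions, Set.mem_ofPred_eq, not_and] at hQP
    have := hQP hQ
    push Not at this
    obtain ⟨l, a, ha, hne⟩ := this
    have hop : ∀ᶠ z : (S → ℝ) × (S → ℝ) in 𝓝 (P, Q), marginalFun l z.1 a ≠ marginalFun l z.2 a :=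
      (((continuous_marginalFun l a).comp continuous_fst).continuousAt).ne_iff_eventually_ne
        (((continuous_marginalFun l a).comp continuous_snd).continuousAt) |>.1 hne
    filter_upwards [hop] with z hz hzc
    exact absurd (hzc.2 l a ha) hz

open Classical in
/-- The sequences in `S` whose marginals have the types prescribed by `c`. -/
def marginalClass (N : ℕ) (c : S → ℕ) : Finset (Fin N → S) :=
  {a | ∀ l v, Finset.card {i | tripleCoord l (a i).1 = v} = ∑ s : S with tripleCoord l s.1 = v, c s}

theorem card_tripleCoord_eq {N : ℕ} {k : S → ℕ} {a : Fin N → S} (ha : a ∈ typeClass N k)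
    (l : Fin 3) (v : ℤ) :
    Finset.card {i | tripleCoord l (a i).1 = v} = ∑ s : S with tripleCoord l s.1 = v, k s := by
  rw [mem_typeClass] at ha
  rw [Finset.card_eq_sum_card_fiberwise (f := a)
    (t := ({s : S | tripleCoord l s.1 = v} : Finset S)) fun i hi => by simpa using hi]
  refine Finset.sum_congr rfl fun s hs => ?_
  rw [← ha s, Finset.filter_filter]
  congr 1
  ext i
  simp only [Finset.mem_filter, Finset.mem_univ, true_and] at hs ⊢
  exact ⟨fun h => h.2, fun h => ⟨by rw [h, hs], h⟩⟩

theorem typeClass_subset_marginalClass {N : ℕ} {c : S → ℕ} :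
    typeClass N c ⊆ marginalClass N c := fun a ha => by
  simp only [marginalClass, Finset.mem_filter, Finset.mem_univ, true_and]
  exact card_tripleCoord_eq ha

/-- The empirical distribution of integer counts. -/
def empirical (N : ℕ) (c : S → ℕ) : S → ℝ := fun s => c s / N

theorem marginalFun_empirical (N : ℕ) (c : S → ℕ) (l : Fin 3) (v : ℤ) :
    marginalFun l (empirical N c) v = ((∑ s : S with tripleCoord l s.1 = v, c s : ℕ) : ℝ) / N := by
  simp only [marginalFun, empirical]
  push_cast
  rw [Finset.sum_div]

/-- The conditional entropy bound. Given the coordinates b, draw each letter from Q conditioned on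
its coordinate: every sequence counted has the same probability exp(−N(H(Q) − H(Q_l))), and
probabilities sum to at most 1. -/
theorem card_typeClass_filter_le {N : ℕ} (hN : 0 < N) (k : S → ℕ) (l : Fin 3) (b : Fin N → ℤ) :
    (Finset.card {a ∈ typeClass N k | ∀ i, tripleCoord l (a i).1 = b i} : ℝ) ≤
      Real.exp (N * (entropyOn (empirical N k) - marginalEntropy l (empirical N k))) := by
  have hN' : (0 : ℝ) < N := by exact_mod_cast hN
  set Q := empirical N k with hQ
  have hQ0 : ∀ s, 0 ≤ Q s := fun s => by simp only [hQ, empirical]; positivity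
  have hm0 : ∀ v, 0 ≤ marginalFun l Q v := fun v => Finset.sum_nonneg fun s _ => hQ0 s
  let w : (Fin N → S) → ℝ := fun a => ∏ i, Q (a i) / marginalFun l Q (b i)
  have hw : ∀ a ∈ ({a ∈ typeClass N k | ∀ i, tripleCoord l (a i).1 = b i} : Finset _),
      Real.exp (-(N * (entropyOn Q - marginalEntropy l Q))) ≤ w a := by
    intro a ha
    obtain ⟨ha, hb⟩ := Finset.mem_filter.1 ha
    have hQa : ∀ i, 0 < Q (a i) := fun i => by
      have : 0 < k (a i) := by
        rw [← mem_typeClass.1 ha (a i)]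
        exact Finset.card_pos.2 ⟨i, by simp⟩
      simp only [hQ, empirical]
      positivity
    have hmb : ∀ i, 0 < marginalFun l Q (b i) := fun i =>
      (hQa i).trans_le (Finset.single_le_sum (f := Q) (fun s _ => hQ0 s) (by simp [hb]))
    have hwpos : 0 < w a := Finset.prod_pos fun i _ => div_pos (hQa i) (hmb i)
    rw [← Real.le_log_iff_exp_le hwpos, Real.log_prod fun i _ => (div_pos (hQa i) (hmb i)).ne']
    have h1 : ∑ i, Real.log (Q (a i)) = -(N * entropyOn Q) := by
      rw [sum_comp_eq_of_mem_typeClass ha fun s => Real.log (Q s), entropyOn, Finset.mul_sum,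
        ← Finset.sum_neg_distrib]
      refine Finset.sum_congr rfl fun s _ => ?_
      simp only [hQ, empirical, Real.negMulLog]
      field_simp
    have h2 : ∑ i, Real.log (marginalFun l Q (b i)) = -(N * marginalEntropy l Q) := by
      have h3 : ∑ i, Real.log (marginalFun l Q (b i)) =
          ∑ i, Real.log (marginalFun l Q (tripleCoord l (a i).1)) := by simp only [hb]
      rw [h3, sum_comp_eq_of_mem_typeClass ha fun s =>
        Real.log (marginalFun l Q (tripleCoord l s.1)), marginalEntropy, Finset.mul_sum,
        ← Finset.sum_neg_distrib, ← Finset.sum_fiberwise_of_maps_to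
          (t := S.image (tripleCoord l)) (g := fun s : S => tripleCoord l s.1)
          fun s _ => Finset.mem_image_of_mem _ s.2]
      refine Finset.sum_congr rfl fun v _ => ?_
      have h4 : ∑ s : S with tripleCoord l s.1 = v,
          (k s : ℝ) * Real.log (marginalFun l Q (tripleCoord l s.1)) =
          ∑ s : S with tripleCoord l s.1 = v, (k s : ℝ) * Real.log (marginalFun l Q v) :=
        Finset.sum_congr rfl fun s hs => by rw [(Finset.mem_filter.1 hs).2]
      have h5 : ∑ s : S with tripleCoord l s.1 = v, (k s : ℝ) = N * marginalFun l Q v := by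
        rw [hQ, marginalFun_empirical]
        push_cast
        field_simp
      rw [h4, ← Finset.sum_mul, h5, Real.negMulLog]
      ring
    have h3 : ∑ i, Real.log (Q (a i) / marginalFun l Q (b i)) =
        ∑ i, Real.log (Q (a i)) - ∑ i, Real.log (marginalFun l Q (b i)) := by
      rw [← Finset.sum_sub_distrib]
      exact Finset.sum_congr rfl fun i _ => Real.log_div (hQa i).ne' (hmb i).ne'
    rw [h3, h1, h2]
    linarith
  have hsum : ∑ a ∈ typeClass N k with ∀ i, tripleCoord l (a i).1 = b i, w a ≤ 1 := by
    calc ∑ a ∈ typeClass N k with ∀ i, tripleCoord l (a i).1 = b i, w a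
        ≤ ∑ a ∈ Fintype.piFinset fun i => ({s : S | tripleCoord l s.1 = b i} : Finset S), w a := by
          refine Finset.sum_le_sum_of_subset_of_nonneg (fun a ha => ?_) fun a _ _ =>
            Finset.prod_nonneg fun i _ => div_nonneg (hQ0 _) (hm0 _)
          simpa using (Finset.mem_filter.1 ha).2
      _ = ∏ i, ∑ s : S with tripleCoord l s.1 = b i, Q s / marginalFun l Q (b i) := by
          rw [Finset.prod_univ_sum]
      _ ≤ 1 := by
          refine Finset.prod_le_one (fun i _ => Finset.sum_nonneg fun s _ =>
            div_nonneg (hQ0 _) (hm0 _)) fun i _ => ?_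
          rw [← Finset.sum_div]
          exact div_self_le_one (marginalFun l Q (b i))
  have h := (Finset.card_nsmul_le_sum _ _ _ hw).trans hsum
  rw [nsmul_eq_mul, Real.exp_neg, ← div_eq_mul_inv, div_le_one (Real.exp_pos _)] at h
  exact h

/-- Sort the sequences by their type. There are at most (N + 1)^|S| types, and each that occurs has
the marginals of c, so its entropy is at most H. -/
theorem card_marginalClass_filter_le {N : ℕ} (hN : 0 < N) (c : S → ℕ) {H : ℝ}
    (hH : ∀ Q ∈ compatibleDistributions (empirical N c), entropyOn Q ≤ H) (l : Fin 3)
    (b : Fin N → ℤ) :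
    (Finset.card {a ∈ marginalClass N c | ∀ i, tripleCoord l (a i).1 = b i} : ℝ) ≤
      (N + 1 : ℝ) ^ S.card * Real.exp (N * (H - marginalEntropy l (empirical N c))) := by
  have hN' : (0 : ℝ) < N := by exact_mod_cast hN
  let T : Finset (S → ℕ) := Fintype.piFinset fun _ => Finset.range (N + 1)
  have hT : T.card = (N + 1) ^ S.card := by simp [T]
  let ty : (Fin N → S) → S → ℕ := fun a s => Finset.card {i | a i = s}
  have hmaps : ∀ a ∈ ({a ∈ marginalClass N c | ∀ i, tripleCoord l (a i).1 = b i} : Finset _),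
      ty a ∈ T := fun a _ => by
    simp only [T, ty, Fintype.mem_piFinset, Finset.mem_range, Nat.lt_succ_iff]
    exact fun s => (Finset.card_le_univ _).trans (by simp)
  rw [Finset.card_eq_sum_card_fiberwise hmaps]
  push_cast
  have hk : ∀ k ∈ T, (Finset.card {a ∈ ({a ∈ marginalClass N c |
      ∀ i, tripleCoord l (a i).1 = b i} : Finset _) | ty a = k} : ℝ) ≤
      Real.exp (N * (H - marginalEntropy l (empirical N c))) := by
    intro k _
    rcases Finset.eq_empty_or_nonempty ({a ∈ ({a ∈ marginalClass N c |
      ∀ i, tripleCoord l (a i).1 = b i} : Finset _) | ty a = k}) with h0 | ⟨a, ha⟩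
    · rw [h0]
      simp only [Finset.card_empty, Nat.cast_zero]
      positivity
    · simp only [Finset.mem_filter, marginalClass, Finset.mem_univ, true_and] at ha
      obtain ⟨⟨ha, -⟩, rfl⟩ := ha
      have hat : a ∈ typeClass N (ty a) := mem_typeClass.2 fun s => rfl
      have hmarg : ∀ l' v, marginalFun l' (empirical N c) v =
          marginalFun l' (empirical N (ty a)) v := fun l' v => by
        rw [marginalFun_empirical, marginalFun_empirical, ← ha, card_tripleCoord_eq hat]
      have hcomp : empirical N (ty a) ∈ compatibleDistributions (empirical N c) := by
        refine ⟨⟨fun s => by simp only [empirical]; positivity, ?_⟩, fun l' v _ => hmarg l' v⟩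
        simp only [empirical]
        rw [← Finset.sum_div, div_eq_one_iff_eq hN'.ne']
        have := Finset.card_eq_sum_card_fiberwise (s := (Finset.univ : Finset (Fin N)))
          (t := Finset.univ) (f := a) fun _ _ => Finset.mem_coe.2 (Finset.mem_univ _)
        rw [Finset.card_univ, Fintype.card_fin] at this
        exact_mod_cast this.symm
      have hent : marginalEntropy l (empirical N c) = marginalEntropy l (empirical N (ty a)) := by
        simp only [marginalEntropy, hmarg]
      rw [hent]
      refine le_trans ?_ ((card_typeClass_filter_le hN (ty a) l b).trans (Real.exp_le_exp.2 ?_))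
      · exact_mod_cast Finset.card_le_card fun a' ha' => by
          simp only [Finset.mem_filter] at ha' ⊢
          exact ⟨mem_typeClass.2 fun s => congrFun ha'.2 s, ha'.1.2⟩
      · have := hH _ hcomp
        gcongr
  refine (Finset.sum_le_card_nsmul _ _ _ hk).trans (le_of_eq ?_)
  rw [hT, nsmul_eq_mul]
  push_cast
  rfl

end Entropy
end

/-! ### Non-interacting triples of sequences -/

noncomputable section

section Blocks

variable {S : Finset (ℤ × ℤ × ℤ)} {N : ℕ}

/-- The `r`-th coordinates of a triple of sequences, cyclically shifted in the three components. -/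
def cycBlock (r : Fin 3) (ω : Fin 3 → Fin N → S) : Fin 3 × Fin N → ℤ :=
  fun q => tripleCoord (q.1 + r) (ω q.1 q.2).1

theorem ext_tripleCoord {s s' : ℤ × ℤ × ℤ} (h : ∀ l, tripleCoord l s = tripleCoord l s') :
    s = s' :=
  Prod.ext (h 0) (Prod.ext (h 1) (h 2))

/-- The triples of sequences all of whose marginals have the types prescribed by `c`. -/
def marginalTriples (N : ℕ) (c : S → ℕ) : Finset (Fin 3 → Fin N → S) :=
  Fintype.piFinset fun _ => marginalClass N c

/-- The l-th coordinates of the p-th sequence sit in the block r = l − p, so all nine marginal types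
can be read off from the three blocks. Hence every triple that could interact with selected ones is
already among those counted for the fibres. -/
theorem mem_marginalTriples_of_cycBlock_eq {c : S → ℕ} {ω : Fin 3 → Fin N → S}
    {g : Fin 3 → Fin 3 → Fin N → S} (hg : ∀ r p, g r p ∈ typeClass N c)
    (h : ∀ r, cycBlock r ω = cycBlock r (g r)) : ω ∈ marginalTriples N c := by
  classical
  rw [marginalTriples, Fintype.mem_piFinset]
  intro p
  simp only [marginalClass, Finset.mem_filter, Finset.mem_univ, true_and]
  intro l v
  rw [← card_tripleCoord_eq (hg (l - p) p) l v]
  congr 1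
  ext i
  have := congrFun (h (l - p)) (p, i)
  simp only [cycBlock, add_sub_cancel] at this
  simp [this]

/-- As p varies, p + r runs through all three coordinates, so each fibre bound involves the sum of
all marginal entropies, whatever r is. -/
theorem card_cycBlock_fiber_le (hN : 0 < N) (c : S → ℕ) {H : ℝ}
    (hH : ∀ Q ∈ compatibleDistributions (empirical N c), entropyOn Q ≤ H) (r : Fin 3)
    (b : Fin 3 × Fin N → ℤ) :
    (Finset.card {ω ∈ marginalTriples N c | cycBlock r ω = b} : ℝ) ≤
      ((N + 1 : ℝ) ^ S.card) ^ 3 *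
        Real.exp (N * (3 * H - ∑ l, marginalEntropy l (empirical N c))) := by
  classical
  have hsub : ({ω ∈ marginalTriples N c | cycBlock r ω = b} : Finset _) ⊆
      Fintype.piFinset fun p => {a ∈ marginalClass N c |
        ∀ i, tripleCoord (p + r) (a i).1 = b (p, i)} := by
    intro ω hω
    simp only [Finset.mem_filter, marginalTriples, Fintype.mem_piFinset] at hω ⊢
    exact fun p => ⟨hω.1 p, fun i => congrFun hω.2 (p, i)⟩
  have h1 : (Finset.card {ω ∈ marginalTriples N c | cycBlock r ω = b} : ℝ) ≤
      ∏ p : Fin 3, (Finset.card {a ∈ marginalClass N c |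
        ∀ i, tripleCoord (p + r) (a i).1 = b (p, i)} : ℝ) := by
    have := Finset.card_le_card hsub
    rw [Fintype.card_piFinset] at this
    exact_mod_cast this
  refine h1.trans ((Finset.prod_le_prod (fun _ _ => by positivity) fun p _ =>
    card_marginalClass_filter_le hN c hH (p + r) fun i => b (p, i)).trans (le_of_eq ?_))
  rw [Finset.prod_mul_distrib, Finset.prod_const, ← Real.exp_sum, ← Finset.mul_sum,
    Finset.sum_sub_distrib, Finset.sum_const, Finset.card_univ, Fintype.card_fin, nsmul_eq_mul]
  have := Equiv.sum_comp (Equiv.addRight r) fun l => marginalEntropy l (empirical N c)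
  simp only [Equiv.coe_addRight] at this
  rw [this]
  push_cast
  rfl

theorem intCast_zmod_inj {M : ℕ} {a b : ℤ} {K : ℕ} (hM : 2 * K < M) (ha : |a| ≤ K) (hb : |b| ≤ K)
    (h : (a : ZMod M) = b) : a = b := by
  rw [ZMod.intCast_eq_intCast_iff_dvd_sub] at h
  have h1 : |b - a| < M := by
    have := abs_sub b a
    have : |b - a| ≤ |b| + |a| := abs_sub _ _
    zify at hM
    omega
  have := Int.eq_zero_of_abs_lt_dvd h h1
  omega

/-- Hashing applied to the triples of sequences of a given type. -/
theorem exists_isolated_typeClass {d : ℤ} (hd : ∀ s ∈ S, s.1 + s.2.1 + s.2.2 = d) {K : ℕ}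
    (hK : ∀ s ∈ S, ∀ l, |tripleCoord l s| ≤ K) (c : S → ℕ) {R M : ℕ} (hM : M.Prime)
    (hKM : 2 * K < M) (hR : ∀ (r : Fin 3) (b : Fin 3 × Fin N → ℤ),
      Finset.card {ω ∈ marginalTriples N c | cycBlock r ω = b} ≤ R) (B : Finset ℕ)
    (hB : ThreeAPFree (B : Set ℕ)) (hBs : B ⊆ Finset.range ((M + 1) / 2)) :
    ∃ G : Finset (Fin 3 → Fin N → S), (∀ g ∈ G, ∀ p, g p ∈ typeClass N c) ∧
      (((typeClass N c).card : ℝ) ^ 3 * B.card * (M - 3 * R) ≤ G.card * (M : ℝ) ^ 3) ∧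
      (∀ ω : Fin 3 → Fin N → S, ∀ g₁ ∈ G, ∀ g₂ ∈ G, ∀ g₃ ∈ G, cycBlock 0 ω = cycBlock 0 g₁ →
        cycBlock 1 ω = cycBlock 1 g₂ → cycBlock 2 ω = cycBlock 2 g₃ → g₁ = g₂ ∧ g₂ = g₃) := by
  classical
  have hd' : ∀ s ∈ S, ∀ p : Fin 3,
      tripleCoord (p + 0) s + tripleCoord (p + 1) s + tripleCoord (p + 2) s = d := by
    intro s hs p
    have := hd s hs
    fin_cases p
    · exact this
    · have h : s.2.1 + s.2.2 + s.1 = d := by omega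
      exact h
    · have h : s.2.2 + s.1 + s.2.1 = d := by omega
      exact h
  let Ω := marginalTriples N c
  let G₀ : Finset (Fin 3 → Fin N → S) := Fintype.piFinset fun _ => typeClass N c
  have hG₀Ω : G₀ ⊆ Ω := Fintype.piFinset_subset _ _ fun _ => typeClass_subset_marginalClass
  have hG₀card : G₀.card = (typeClass N c).card ^ 3 := by simp [G₀]
  have := Fact.mk hM
  let x : Fin 3 → (Fin 3 → Fin N → S) → Fin 3 × Fin N → ZMod M := fun r ω q => (cycBlock r ω q : ℤ)
  have hx : ∀ r ω ω', x r ω = x r ω' → cycBlock r ω = cycBlock r ω' := fun r ω ω' h => by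
    funext q
    exact intCast_zmod_inj hKM (hK _ (ω q.1 q.2).2 _) (hK _ (ω' q.1 q.2).2 _) (congrFun h q)
  have hxfib : ∀ r, ∀ g ∈ G₀, Finset.card {ω ∈ Ω | x r ω = x r g} ≤ R := fun r g _ => by
    refine le_trans (Finset.card_le_card ?_) (hR r (cycBlock r g))
    exact Finset.monotone_filter_right _ fun ω _ h => hx r ω g h
  obtain ⟨G, hG, hGc, hiso⟩ := exists_isolated_subset (x 0) (x 1) (x 2) Ω G₀ hG₀Ω
    (fun _ => (d : ZMod M)) (fun ω _ => by
      funext q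
      simp only [x, Pi.add_apply, cycBlock]
      exact_mod_cast congrArg (Int.cast : ℤ → ZMod M) (hd' _ (ω q.1 q.2).2 q.1))
    -- Two of the coordinates of a point of S determine the third, because the sum is d.
    (fun ω _ ω' _ h0 h1 => by
      have h0 := hx _ _ _ h0
      have h1 := hx _ _ _ h1
      funext p i
      have e0 := congrFun h0 (p, i)
      have e1 := congrFun h1 (p, i)
      simp only [cycBlock] at e0 e1
      have e2 : tripleCoord (p + 2) (ω p i).1 = tripleCoord (p + 2) (ω' p i).1 := by
        have f1 := hd' _ (ω p i).2 p
        have f2 := hd' _ (ω' p i).2 p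
        rw [e0, e1] at f1
        omega
      refine Subtype.ext (ext_tripleCoord fun l => ?_)
      have : ∀ l p : Fin 3, l = p + 0 ∨ l = p + 1 ∨ l = p + 2 := by decide
      rcases this l p with rfl | rfl | rfl <;> assumption)
    R (hxfib 0) (hxfib 1) (hxfib 2) B hB hBs
  have hGtype : ∀ g ∈ G, ∀ p, g p ∈ typeClass N c := fun g hg p =>
    Fintype.mem_piFinset.1 (hG hg) p
  refine ⟨G, hGtype, by rw [hG₀card] at hGc; exact_mod_cast hGc, ?_⟩
  intro ω g₁ hg₁ g₂ hg₂ g₃ hg₃ e0 e1 e2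
  have hω : ω ∈ Ω := by
    refine mem_marginalTriples_of_cycBlock_eq (g := ![g₁, g₂, g₃]) (fun r p => ?_) fun r => ?_
    · fin_cases r
      exacts [hGtype _ hg₁ p, hGtype _ hg₂ p, hGtype _ hg₃ p]
    · fin_cases r
      exacts [e0, e1, e2]
  obtain ⟨h1, h2, h3⟩ := hiso ω hω g₁ hg₁ g₂ hg₂ g₃ hg₃ (by simp only [x, e0])
    (by simp only [x, e1]) (by simp only [x, e2])
  exact ⟨h1.symm.trans h2, h2.symm.trans h3⟩

/-- Many non-interacting triples of sequences of a given type. -/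
theorem exists_isolated_triples (hS : IsTightSupport S) :
    ∃ D : ℝ, 1 ≤ D ∧ ∀ (N : ℕ) (c : S → ℕ) (H : ℝ), 0 < N → ∑ s, c s = N →
      (∀ Q ∈ compatibleDistributions (empirical N c), entropyOn Q ≤ H) →
      ∃ G : Finset (Fin 3 → Fin N → S), G.Nonempty ∧ (∀ g ∈ G, ∀ p, g p ∈ typeClass N c) ∧
        (∀ ω : Fin 3 → Fin N → S, ∀ g₁ ∈ G, ∀ g₂ ∈ G, ∀ g₃ ∈ G, cycBlock 0 ω = cycBlock 0 g₁ →
          cycBlock 1 ω = cycBlock 1 g₂ → cycBlock 2 ω = cycBlock 2 g₃ → g₁ = g₂ ∧ g₂ = g₃) ∧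
        let L : ℝ := Real.log D + 3 * S.card * Real.log (N + 1) +
          N * (3 * H - ∑ l, marginalEntropy l (empirical N c))
        3 * Real.log (typeClass N c).card - L - 4 * √L - Real.log 4 ≤ Real.log G.card := by
  classical
  obtain ⟨d, hd⟩ := hS
  obtain ⟨K, hK⟩ : ∃ K : ℕ, ∀ s ∈ S, ∀ l, |tripleCoord l s| ≤ K := by
    refine ⟨∑ s ∈ S, ∑ l, (tripleCoord l s).natAbs, fun s hs l => ?_⟩
    have h1 := Finset.single_le_sum (f := fun l => (tripleCoord l s).natAbs)
      (fun _ _ => Nat.zero_le _) (Finset.mem_univ l)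
    have h2 := Finset.single_le_sum (f := fun s => ∑ l, (tripleCoord l s).natAbs)
      (fun _ _ => Nat.zero_le _) hs
    rw [Int.abs_eq_natAbs]
    exact_mod_cast h1.trans h2
  have hK0 : (0 : ℝ) ≤ K := by positivity
  refine ⟨4 * K + 18, by linarith, fun N c H hN hc hH => ?_⟩
  set Fb : ℝ := ((N + 1 : ℝ) ^ S.card) ^ 3 *
    Real.exp (N * (3 * H - ∑ l, marginalEntropy l (empirical N c))) with hFb
  have hFbpos : 0 < Fb := by positivity
  have hfib : ∀ r b, (Finset.card {ω ∈ marginalTriples N c | cycBlock r ω = b} : ℝ) ≤ Fb :=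
    fun r b => card_cycBlock_fiber_le hN c hH r b
  set R := ⌊Fb⌋₊ with hR
  have htype := (typeClass_nonempty hc).card_pos
  have hR1 : 1 ≤ R := by
    obtain ⟨a, ha⟩ := typeClass_nonempty hc
    rw [hR, Nat.one_le_floor_iff]
    refine le_trans ?_ (hfib 0 (cycBlock 0 fun _ => a))
    have : 0 < Finset.card {ω ∈ marginalTriples N c | cycBlock 0 ω = cycBlock 0 fun _ => a} :=
      Finset.card_pos.2 ⟨fun _ => a, Finset.mem_filter.2
        ⟨Fintype.mem_piFinset.2 fun _ => typeClass_subset_marginalClass ha, rfl⟩⟩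
    exact_mod_cast this
  -- Bertrand's postulate. The term 6R ensures M − 3R ≥ M/2, and 2K makes reduction of coordinates
  -- modulo M injective. Since `Fb` ≥ R ≥ 1, the upper bound is at most (4K + 18) `Fb`, whence the
  -- choice of D.
  obtain ⟨M, hMp, hM1, hM2⟩ := Nat.exists_prime_lt_and_le_two_mul (6 * R + 2 * K + 3) (by omega)
  obtain ⟨B, hBs, hBc, hB⟩ := rothNumberNat_spec ((M + 1) / 2)
  obtain ⟨G, hGtype, hGc, hiso⟩ := exists_isolated_typeClass hd hK c (R := R) hMp (by omega)
    (fun r b => Nat.le_floor (hfib r b)) B hB hBs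
  have hMR : (6 * R : ℝ) ≤ M := by exact_mod_cast (by omega : 6 * R ≤ M)
  have hMpos : (0 : ℝ) < M := by exact_mod_cast hMp.pos
  have hRFb : (R : ℝ) ≤ Fb := Nat.floor_le hFbpos.le
  have hR1' : (1 : ℝ) ≤ R := by exact_mod_cast hR1
  have hMle : (M : ℝ) ≤ (4 * K + 18) * Fb := by
    have : (M : ℝ) ≤ 2 * (6 * R + 2 * K + 3) := by exact_mod_cast hM2
    nlinarith
  have hlogM : Real.log M ≤ Real.log (4 * K + 18) + 3 * S.card * Real.log (N + 1) +
      N * (3 * H - ∑ l, marginalEntropy l (empirical N c)) := by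
    refine (Real.log_le_log hMpos hMle).trans (le_of_eq ?_)
    rw [Real.log_mul (by positivity) hFbpos.ne', hFb, Real.log_mul (by positivity)
      (Real.exp_pos _).ne', Real.log_exp, Real.log_pow, Real.log_pow]
    push_cast
    ring
  set L := Real.log (4 * K + 18) + 3 * S.card * Real.log (N + 1) +
      N * (3 * H - ∑ l, marginalEntropy l (empirical N c)) with hL
  -- Behrend's bound, with log M replaced by its upper bound L in the exponent; the loss √L is o(N).
  have hBlow : (M / 2 : ℝ) * Real.exp (-4 * √L) ≤ B.card := by
    rw [hBc]
    refine le_trans ?_ (Behrend.roth_lower_bound (N := (M + 1) / 2))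
    have h1 : (M / 2 : ℝ) ≤ ((M + 1) / 2 : ℕ) := by
      rw [div_le_iff₀ two_pos]
      exact_mod_cast (by omega : M ≤ (M + 1) / 2 * 2)
    have h2 : Real.log ((M + 1) / 2 : ℕ) ≤ L := by
      refine (Real.log_le_log (lt_of_lt_of_le (by positivity) h1) ?_).trans hlogM
      exact_mod_cast (by have := hMp.pos; omega : (M + 1) / 2 ≤ M)
    have h3 := Real.sqrt_le_sqrt h2
    exact mul_le_mul h1 (Real.exp_le_exp.2 (by linarith)) (Real.exp_pos _).le (by positivity)
  have hmain : ((typeClass N c).card : ℝ) ^ 3 * Real.exp (-4 * √L) ≤ 4 * (G.card * M) := by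
    have h1 : ((typeClass N c).card : ℝ) ^ 3 * ((M / 2 : ℝ) * Real.exp (-4 * √L)) * (M / 2) ≤
        G.card * (M : ℝ) ^ 3 := by
      refine le_trans ?_ hGc
      have : (M : ℝ) / 2 ≤ M - 3 * R := by linarith
      gcongr
    have h2 : (M : ℝ) ^ 2 * (((typeClass N c).card : ℝ) ^ 3 * Real.exp (-4 * √L)) ≤
        (M : ℝ) ^ 2 * (4 * (G.card * M)) := by linarith
    exact le_of_mul_le_mul_left h2 (by positivity)
  have htype' : (0 : ℝ) < (typeClass N c).card := by exact_mod_cast htype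
  have hGpos : 0 < G.card := by
    by_contra h0
    rw [Nat.eq_zero_of_not_pos h0] at hmain
    have : 0 < ((typeClass N c).card : ℝ) ^ 3 * Real.exp (-4 * √L) := by positivity
    simp only [Nat.cast_zero, zero_mul, mul_zero] at hmain
    linarith
  have hGpos' : (0 : ℝ) < G.card := by exact_mod_cast hGpos
  refine ⟨G, Finset.card_pos.1 hGpos, hGtype, hiso, ?_⟩
  have h1 := Real.log_le_log (by positivity) hmain
  rw [Real.log_mul (by positivity) (Real.exp_pos _).ne', Real.log_exp, Real.log_pow,
    Real.log_mul (by positivity) (by positivity), Real.log_mul (by positivity) hMpos.ne'] at h1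
  push_cast at h1
  show 3 * Real.log (typeClass N c).card - L - 4 * √L - Real.log 4 ≤ Real.log G.card
  linarith

end Blocks
end

/-! ### Blocks of the symmetrized power -/

noncomputable section

namespace CoordTensor

variable {F : Type*} [Field F] {ι κ μ : Type*} [Fintype ι] [Fintype κ] [Fintype μ]
  {S : Finset (ℤ × ℤ × ℤ)} {N : ℕ}

/-- The block of `t` of degree `s` for gradings of the index sets. -/
def block (gι : ι → ℤ) (gκ : κ → ℤ) (gμ : μ → ℤ) (t : CoordTensor F ι κ μ) (s : ℤ × ℤ × ℤ) :
    CoordTensor F ι κ μ :=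
  fun i j k => if (gι i, gκ j, gμ k) = s then t i j k else 0

/-- The degrees of an index of a power of `t ⊗ t_C ⊗ t_{C²}`. -/
def degrees {α β γ : Type*} (f : α → ℤ) (g : β → ℤ) (h : γ → ℤ) (i : Fin N → (α × β) × γ) :
    Fin 3 × Fin N → ℤ :=
  fun q => (![f (i q.2).1.1, g (i q.2).1.2, h (i q.2).2] : Fin 3 → ℤ) q.1

theorem forall_fin_three_prod {p : Fin 3 × Fin N → Prop} :
    (∀ q, p q) ↔ ∀ l, p (0, l) ∧ p (1, l) ∧ p (2, l) := by
  constructor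
  · exact fun h l => ⟨h _, h _, h _⟩
  · rintro h ⟨r, l⟩
    fin_cases r
    exacts [(h l).1, (h l).2.1, (h l).2.2]

omit [Fintype ι] [Fintype κ] [Fintype μ] in
theorem degrees_eq_cycBlock_iff (gι : ι → ℤ) (gκ : κ → ℤ) (gμ : μ → ℤ) (ω : Fin 3 → Fin N → S)
    (i : Fin N → (ι × κ) × μ) (j : Fin N → (κ × μ) × ι) (k : Fin N → (μ × ι) × κ) :
    (degrees gι gκ gμ i = cycBlock 0 ω ∧ degrees gκ gμ gι j = cycBlock 1 ω ∧
      degrees gμ gι gκ k = cycBlock 2 ω) ↔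
    ∀ l, (gι (i l).1.1, gκ (j l).1.1, gμ (k l).1.1) = (ω 0 l).1 ∧
      (gι (k l).1.2, gκ (i l).1.2, gμ (j l).1.2) = (ω 1 l).1 ∧
      (gι (j l).2, gκ (k l).2, gμ (i l).2) = (ω 2 l).1 := by
  simp only [funext_iff, forall_fin_three_prod, ← forall_and]
  refine forall_congr' fun l => ?_
  simp only [degrees, cycBlock, tripleCoord, Prod.ext_iff]
  simp only [Matrix.cons_val_zero, Matrix.cons_val_one, Matrix.cons_val, Fin.isValue,
    show (1 + 1 : Fin 3) = 2 from rfl, show (1 + 2 : Fin 3) = 0 from rfl,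
    show (2 + 1 : Fin 3) = 0 from rfl, show (2 + 2 : Fin 3) = 1 from rfl, add_zero, zero_add]
  tauto

omit [Fintype ι] [Fintype κ] [Fintype μ] in
theorem power_tri_apply (t : CoordTensor F ι κ μ) (i : Fin N → (ι × κ) × μ)
    (j : Fin N → (κ × μ) × ι) (k : Fin N → (μ × ι) × κ) :
    power (tri t) N i j k = ∏ l, t (i l).1.1 (j l).1.1 (k l).1.1 *
      t (k l).1.2 (i l).1.2 (j l).1.2 * t (j l).2 (k l).2 (i l).2 := rfl

omit [Fintype ι] [Fintype κ] [Fintype μ] in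
theorem exists_degrees_eq_cycBlock {gι : ι → ℤ} {gκ : κ → ℤ} {gμ : μ → ℤ}
    {t : CoordTensor F ι κ μ} (hS : ∀ i j k, t i j k ≠ 0 → (gι i, gκ j, gμ k) ∈ S)
    {i : Fin N → (ι × κ) × μ} {j : Fin N → (κ × μ) × ι} {k : Fin N → (μ × ι) × κ}
    (h : power (tri t) N i j k ≠ 0) :
    ∃ ω : Fin 3 → Fin N → S, degrees gι gκ gμ i = cycBlock 0 ω ∧
      degrees gκ gμ gι j = cycBlock 1 ω ∧ degrees gμ gι gκ k = cycBlock 2 ω := by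
  rw [power_tri_apply, Finset.prod_ne_zero_iff] at h
  have h' := fun l => mul_ne_zero_iff.1 (h l (Finset.mem_univ l))
  refine ⟨![fun l => ⟨_, hS _ _ _ (mul_ne_zero_iff.1 (h' l).1).1⟩,
    fun l => ⟨_, hS _ _ _ (mul_ne_zero_iff.1 (h' l).1).2⟩,
    fun l => ⟨_, hS _ _ _ (h' l).2⟩], ?_⟩
  rw [degrees_eq_cycBlock_iff]
  exact fun l => ⟨rfl, rfl, rfl⟩

theorem isRestriction_degrees_block (gι : ι → ℤ) (gκ : κ → ℤ) (gμ : μ → ℤ)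
    (t : CoordTensor F ι κ μ) {c : S → ℕ} {ω : Fin 3 → Fin N → S}
    (hω : ∀ p, ω p ∈ typeClass N c) :
    IsRestriction (piProd fun s : S => power (tri (block gι gκ gμ t s)) (c s))
      (fun i j k => if degrees gι gκ gμ i = cycBlock 0 ω ∧ degrees gκ gμ gι j = cycBlock 1 ω ∧
        degrees gμ gι gκ k = cycBlock 2 ω then power (tri t) N i j k else 0) := by
  have heq : (fun i j k => if degrees gι gκ gμ i = cycBlock 0 ω ∧
      degrees gκ gμ gι j = cycBlock 1 ω ∧ degrees gμ gι gκ k = cycBlock 2 ω then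
        power (tri t) N i j k else 0) = fun i j k =>
      ∏ l, block gι gκ gμ t (ω 0 l) (i l).1.1 (j l).1.1 (k l).1.1 *
        block gι gκ gμ t (ω 1 l) (k l).1.2 (i l).1.2 (j l).1.2 *
        block gι gκ gμ t (ω 2 l) (j l).2 (k l).2 (i l).2 := by
    ext i j k
    simp only [degrees_eq_cycBlock_iff]
    split_ifs with h
    · rw [power_tri_apply]
      refine Finset.prod_congr rfl fun l _ => ?_
      simp only [block, if_pos (h l).1, if_pos (h l).2.1, if_pos (h l).2.2]
    · obtain ⟨l, hl⟩ := not_forall.1 h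
      refine (Finset.prod_eq_zero (Finset.mem_univ l) ?_).symm
      simp only [block]
      split_ifs <;> simp_all
  rw [heq]
  -- Each symbol s occurs c s times in each of the three sequences, but at different positions.
  -- Separate bijections line up these occurrences, and one factor from each sequence then makes up
  -- a copy of `tri` of the block s.
  choose e he using fun p => exists_equiv_of_mem_typeClass (hω p)
  refine IsRestriction.of_comap
    (fun i l => (((i (e 0 l).1 (e 0 l).2).1.1, (i (e 1 l).1 (e 1 l).2).1.2),
      (i (e 2 l).1 (e 2 l).2).2))
    (fun i l => (((i (e 0 l).1 (e 0 l).2).1.1, (i (e 1 l).1 (e 1 l).2).1.2),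
      (i (e 2 l).1 (e 2 l).2).2))
    (fun i l => (((i (e 0 l).1 (e 0 l).2).1.1, (i (e 1 l).1 (e 1 l).2).1.2),
      (i (e 2 l).1 (e 2 l).2).2)) fun i j k => ?_
  simp only [← he, Finset.prod_mul_distrib]
  rw [(e 0).prod_comp fun q => block gι gκ gμ t q.1 (i q.1 q.2).1.1 (j q.1 q.2).1.1
      (k q.1 q.2).1.1,
    (e 1).prod_comp fun q => block gι gκ gμ t q.1 (k q.1 q.2).1.2 (i q.1 q.2).1.2
      (j q.1 q.2).1.2,
    (e 2).prod_comp fun q => block gι gκ gμ t q.1 (j q.1 q.2).2 (k q.1 q.2).2 (i q.1 q.2).2,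
    ← Finset.prod_mul_distrib, ← Finset.prod_mul_distrib, Fintype.prod_sigma]
  rfl

theorem piProd_ne_zero {L : Type*} [Fintype L] {ι κ μ : L → Type*}
    {A : ∀ l, CoordTensor F (ι l) (κ l) (μ l)} (hA : ∀ l, A l ≠ 0) : piProd A ≠ 0 := by
  choose i j k h using fun l => exists_ne_zero_of_ne (hA l)
  intro h0
  have := congrFun (congrFun (congrFun h0 i) j) k
  exact Finset.prod_ne_zero_iff.2 (fun l _ => h l) this

/-- A set of non-interacting blocks of the same type yields a lower bound for the value. -/
theorem log_card_add_sum_logMax_le (ρ : ℝ) {gι : ι → ℤ} {gκ : κ → ℤ} {gμ : μ → ℤ}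
    {t : CoordTensor F ι κ μ} (hS : ∀ i j k, t i j k ≠ 0 → (gι i, gκ j, gμ k) ∈ S)
    (hne : ∀ s ∈ S, block gι gκ gμ t s ≠ 0) {c : S → ℕ} {G : Finset (Fin 3 → Fin N → S)}
    (hG : G.Nonempty) (hGt : ∀ g ∈ G, ∀ p, g p ∈ typeClass N c)
    (hiso : ∀ ω : Fin 3 → Fin N → S, ∀ g₁ ∈ G, ∀ g₂ ∈ G, ∀ g₃ ∈ G, cycBlock 0 ω = cycBlock 0 g₁ →
      cycBlock 1 ω = cycBlock 1 g₂ → cycBlock 2 ω = cycBlock 2 g₃ → g₁ = g₂ ∧ g₂ = g₃) :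
    Real.log G.card + ∑ s : S, logMax ρ (power (tri (block gι gκ gμ t s)) (c s)) ≤
      logMax ρ (power (tri t) N) := by
  have hA : ∀ s : S, power (tri (block gι gκ gμ t s)) (c s) ≠ 0 := fun s =>
    power_ne_zero (tri_ne_zero (hne s s.2)) _
  obtain ⟨p, hp, hpe⟩ := exists_eq_logMax ρ (piProd_ne_zero hA)
  have hGne : Nonempty G := hG.to_subtype
  have hmem : (Fintype.card G * p.1, p.2) ∈ pairs (power (tri t) N) := by
    -- All selected blocks have the same type and therefore yield the same pair p, as adding their
    -- contributions requires.
    refine card_mul_mem_pairs (G := G) (power (tri t) N) (degrees gι gκ gμ) (degrees gκ gμ gι)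
      (degrees gμ gι gκ) (fun g => cycBlock 0 g.1) (fun g => cycBlock 1 g.1)
      (fun g => cycBlock 2 g.1) ?_ fun g =>
        pairs_mono (isRestriction_degrees_block gι gκ gμ t (hGt g g.2)) hp
    intro g₁ g₂ g₃ i j k h1 h2 h3 h
    obtain ⟨ω, e1, e2, e3⟩ := exists_degrees_eq_cycBlock hS h
    have := hiso ω g₁ g₁.2 g₂ g₂.2 g₃ g₃.2 (e1.symm.trans h1) (e2.symm.trans h2) (e3.symm.trans h3)
    exact ⟨Subtype.ext this.1, Subtype.ext this.2⟩
  have h := le_logMax ρ hmem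
  have h0 : (G.card : ℝ) ≠ 0 := by exact_mod_cast hG.card_pos.ne'
  have h1 : (p.1 : ℝ) ≠ 0 := by exact_mod_cast hp.1.ne'
  simp only [Fintype.card_coe, Nat.cast_mul] at h
  rw [Real.log_mul h0 h1] at h
  have h2 := logMax_piProd_le ρ hA
  linarith

section Restriction

variable {ι' κ' μ' ι₁ κ₁ μ₁ ι₁' κ₁' μ₁' : Type*} [Fintype ι'] [Fintype κ'] [Fintype μ']
  [Fintype ι₁'] [Fintype κ₁'] [Fintype μ₁']

omit [Fintype ι] [Fintype κ] [Fintype μ]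

theorem IsRestriction.cyc {t : CoordTensor F ι κ μ} {t' : CoordTensor F ι' κ' μ'}
    (h : IsRestriction t t') : IsRestriction (cyc t) (cyc t') := by
  obtain ⟨a, b, c, h⟩ := h
  refine ⟨b, c, a, fun j k i => ?_⟩
  simp only [CoordTensor.cyc, h]
  rw [Finset.sum_comm]
  refine Finset.sum_congr rfl fun j' _ => ?_
  rw [Finset.sum_comm]
  refine Finset.sum_congr rfl fun k' _ => Finset.sum_congr rfl fun i' _ => ?_
  ring

theorem IsRestriction.prod {t : CoordTensor F ι κ μ} {t' : CoordTensor F ι' κ' μ'}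
    {u : CoordTensor F ι₁ κ₁ μ₁} {u' : CoordTensor F ι₁' κ₁' μ₁'}
    (h : IsRestriction t t') (hu : IsRestriction u u') :
    IsRestriction (prod t u) (prod t' u') := by
  obtain ⟨a, b, c, h⟩ := h
  obtain ⟨a', b', c', hu⟩ := hu
  refine ⟨fun i i' => a i.1 i'.1 * a' i.2 i'.2, fun i i' => b i.1 i'.1 * b' i.2 i'.2,
    fun i i' => c i.1 i'.1 * c' i.2 i'.2, fun i j k => ?_⟩
  simp only [CoordTensor.prod, h, hu, Fintype.sum_prod_type, Finset.sum_mul_sum]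
  refine Finset.sum_congr rfl fun _ _ => Finset.sum_congr rfl fun _ _ =>
    Finset.sum_congr rfl fun _ _ => Finset.sum_congr rfl fun _ _ =>
    Finset.sum_congr rfl fun _ _ => Finset.sum_congr rfl fun _ _ => ?_
  ring

theorem IsRestriction.tri {t : CoordTensor F ι κ μ} {t' : CoordTensor F ι' κ' μ'}
    (h : IsRestriction t t') : IsRestriction (tri t) (tri t') :=
  (h.prod h.cyc).prod h.cyc.cyc

theorem IsRestriction.power {t : CoordTensor F ι κ μ} {t' : CoordTensor F ι' κ' μ'}
    (h : IsRestriction t t') (N : ℕ) : IsRestriction (power t N) (power t' N) := by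
  obtain ⟨a, b, c, h⟩ := h
  refine ⟨fun i i' => ∏ l, a (i l) (i' l), fun i i' => ∏ l, b (i l) (i' l),
    fun i i' => ∏ l, c (i l) (i' l), fun i j k => ?_⟩
  simp_rw [CoordTensor.power, h, Finset.prod_univ_sum, Fintype.piFinset_univ,
    Finset.prod_mul_distrib]

end Restriction

end CoordTensor
end

/-! ### Passage to the limit and conclusion -/

noncomputable section

open Filter Topology

theorem tendsto_log_add_one_div_atTop :
    Tendsto (fun N : ℕ => Real.log (N + 1) / N) atTop (𝓝 0) := by
  have h1 : Tendsto (fun N : ℕ => Real.log ((N : ℝ) + 1) / (N + 1) * (((N : ℝ) + 1) / N)) atTop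
      (𝓝 (0 * 1)) := by
    refine Tendsto.mul ?_ ?_
    · have := (Real.isLittleO_log_id_atTop.tendsto_div_nhds_zero).comp
        (tendsto_natCast_atTop_atTop.comp (tendsto_add_atTop_nat 1))
      refine this.congr fun N => ?_
      simp
    · have h : Tendsto (fun N : ℕ => 1 + 1 / (N : ℝ)) atTop (𝓝 (1 + 0)) :=
        tendsto_const_nhds.add tendsto_one_div_atTop_nhds_zero_nat
      rw [add_zero] at h
      refine h.congr' ?_
      filter_upwards [eventually_gt_atTop 0] with N hN
      have : (N : ℝ) ≠ 0 := by positivity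
      field_simp
  rw [zero_mul] at h1
  refine h1.congr fun N => ?_
  have : (N : ℝ) + 1 ≠ 0 := by positivity
  field_simp

/-- The asymptotic form of the laser method, for abstract superadditive quantities `f s` attached
to the blocks. -/
theorem le_of_forall_isolated_triples {S : Finset (ℤ × ℤ × ℤ)} (hS : IsTightSupport S)
    {P : S → ℝ} (hP : P ∈ stdSimplex ℝ S) {v : ℝ} {w : S → ℝ} {f : S → ℕ → ℝ}
    (hf : ∀ s n, 0 ≤ f s n) (hfw : ∀ s, Tendsto (fun n : ℕ => f s n / n) atTop (𝓝 (w s)))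
    (hmain : ∀ (N : ℕ) (c : S → ℕ) (G : Finset (Fin 3 → Fin N → S)), G.Nonempty →
      (∀ g ∈ G, ∀ p, g p ∈ typeClass N c) →
      (∀ ω : Fin 3 → Fin N → S, ∀ g₁ ∈ G, ∀ g₂ ∈ G, ∀ g₃ ∈ G, cycBlock 0 ω = cycBlock 0 g₁ →
        cycBlock 1 ω = cycBlock 1 g₂ → cycBlock 2 ω = cycBlock 2 g₃ → g₁ = g₂ ∧ g₂ = g₃) →
      Real.log G.card + ∑ s, f s (c s) ≤ N * v) :
    ∑ l, marginalEntropy l P + ∑ s, P s * w s - 3 * entropyGap P ≤ v := by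
  classical
  obtain ⟨D, hD, hiso⟩ := exists_isolated_triples hS
  obtain ⟨c, hcN, hcP⟩ := exists_counts_tendsto hP
  set Hm := sSup (entropyOn '' compatibleDistributions P) with hHm
  refine le_of_forall_pos_le_add fun ε hε => ?_
  -- The entropy bound enters L with a factor 3, so the final loss is ε.
  have hε3 : 0 < ε / 3 := by positivity
  have hemp : Tendsto (fun N => empirical N (c N)) atTop (𝓝 P) := tendsto_pi_nhds.2 hcP
  have hev := hemp.eventually (eventually_entropyOn_compatible_le hP hε3)
  have hlog := tendsto_log_add_one_div_atTop
  have hconst : ∀ x : ℝ, Tendsto (fun N : ℕ => x / N) atTop (𝓝 0) := fun x =>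
    tendsto_const_div_atTop_nhds_zero_nat x
  let L : ℕ → ℝ := fun N => Real.log D + 3 * S.card * Real.log (N + 1) +
    N * (3 * (Hm + ε / 3) - ∑ l, marginalEntropy l (empirical N (c N)))
  have hmarg : Tendsto (fun N : ℕ => ∑ l, marginalEntropy l (empirical N (c N))) atTop
      (𝓝 (∑ l, marginalEntropy l P)) := tendsto_finsetSum _ fun l _ =>
    ((continuous_marginalEntropy l).tendsto P).comp hemp
  have hent : Tendsto (fun N : ℕ => entropyOn (empirical N (c N))) atTop (𝓝 (entropyOn P)) :=
    (continuous_entropyOn.tendsto P).comp hemp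
  have hL : Tendsto (fun N : ℕ => L N / N) atTop
      (𝓝 (3 * (Hm + ε / 3) - ∑ l, marginalEntropy l P)) := by
    have h := ((hconst (Real.log D)).add (hlog.const_mul (3 * (S.card : ℝ)))).add
      (tendsto_const_nhds.sub hmarg (a := 3 * (Hm + ε / 3)))
    simp only [mul_zero, zero_add] at h
    refine h.congr' ?_
    filter_upwards [eventually_gt_atTop 0] with N hN
    have : (N : ℝ) ≠ 0 := by positivity
    simp only [L]
    field_simp
  have hsqrt : Tendsto (fun N : ℕ => √(L N) / N) atTop (𝓝 0) := by
    have h := (Real.continuous_sqrt.tendsto _).comp (hL.mul (hconst 1))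
    simp only [mul_zero, Real.sqrt_zero] at h
    refine h.congr fun N => ?_
    rw [Function.comp, div_mul_div_comm, mul_one, Real.sqrt_div' _ (by positivity),
      Real.sqrt_mul_self (by positivity)]
  -- Where P s = 0 the counts c N s need not tend to infinity, so `hfw` is of no direct use. These
  -- terms are nonnegative and are dropped from the lower bound.
  have hblocks : Tendsto (fun N : ℕ => ∑ s, if P s = 0 then 0 else f s (c N s) / N) atTop
      (𝓝 (∑ s, P s * w s)) := by
    refine tendsto_finsetSum _ fun s _ => ?_
    by_cases hs : P s = 0
    · simp [hs]
    · simp only [hs, if_false]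
      have hpos : 0 < P s := lt_of_le_of_ne (hP.1 s) (Ne.symm hs)
      have hctop : Tendsto (fun N => c N s) atTop atTop := by
        rw [← tendsto_natCast_atTop_iff (R := ℝ)]
        refine ((hcP s).pos_mul_atTop hpos tendsto_natCast_atTop_atTop).congr' ?_
        filter_upwards [eventually_gt_atTop 0] with N hN
        have : (N : ℝ) ≠ 0 := by positivity
        field_simp
      refine ((hcP s).mul ((hfw s).comp hctop)).congr' ?_
      filter_upwards [eventually_gt_atTop 0, hctop.eventually_gt_atTop 0] with N hN hcN
      have : (N : ℝ) ≠ 0 := by positivity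
      have : (c N s : ℝ) ≠ 0 := by positivity
      simp only [Function.comp]
      field_simp
  have hlower := (((((hent.const_mul 3).sub (((hconst 1).add hlog).const_mul
    (3 * (S.card : ℝ)))).sub hL).sub (hsqrt.const_mul 4)).sub (hconst (Real.log 4))).add hblocks
  have hle := le_of_tendsto hlower (b := v) ?_
  · simp only [entropyGap]
    linarith
  filter_upwards [hev, eventually_gt_atTop 0] with N hN hN0
  have hN0' : (0 : ℝ) < N := by exact_mod_cast hN0
  obtain ⟨G, hGne, hGt, hGi, hGc⟩ := hiso N (c N) (Hm + ε / 3) hN0 (hcN N) hN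
  have h1 := hmain N (c N) G hGne hGt hGi
  have h2 := le_log_card_typeClass (hcN N)
  rw [Fintype.card_coe] at h2
  have h3 : ∑ s, (if P s = 0 then 0 else f s (c N s) / N) ≤ (∑ s, f s (c N s)) / N := by
    rw [Finset.sum_div]
    refine Finset.sum_le_sum fun s _ => ?_
    split_ifs
    · exact div_nonneg (hf _ _) hN0'.le
    · exact le_rfl
  have h4 : 3 * (N * entropyOn (empirical N (c N)) - S.card * (1 + Real.log (N + 1))) - L N -
      4 * √(L N) - Real.log 4 + ∑ s, f s (c N s) ≤ N * v := by
    have h5 : entropyOn (empirical N (c N)) = ∑ s, Real.negMulLog (c N s / N) := rfl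
    rw [h5]
    simp only [L]
    linarith
  refine (add_le_add_right h3 _).trans ?_
  rw [← mul_le_mul_iff_right₀ hN0']
  refine le_trans (le_of_eq ?_) h4
  field_simp

namespace TensorDecomposition

open CoordTensor

variable {F : Type*} [Field F] {U V W : Type*}
  [AddCommGroup U] [Module F U] [AddCommGroup V] [Module F V] [AddCommGroup W] [Module F W]
  [FiniteDimensional F U] [FiniteDimensional F V] [FiniteDimensional F W]
  {t : (U ⊗[F] V) ⊗[F] W} (D : TensorDecomposition t)

/-- Transfers the block estimate from adapted to fixed bases. Restrictions in one direction suffice: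
each component restricts from its block of `D.coords`, and `D.coords` restricts from the coordinates
of t. -/
theorem log_card_add_sum_le {s₀ : ℤ × ℤ × ℤ} (hs₀ : s₀ ∈ D.supp) (ρ : ℝ) {N : ℕ} {c : D.supp → ℕ}
    {G : Finset (Fin 3 → Fin N → D.supp)} (hG : G.Nonempty)
    (hGt : ∀ g ∈ G, ∀ p, g p ∈ typeClass N c)
    (hiso : ∀ ω : Fin 3 → Fin N → D.supp, ∀ g₁ ∈ G, ∀ g₂ ∈ G, ∀ g₃ ∈ G,
      cycBlock 0 ω = cycBlock 0 g₁ → cycBlock 1 ω = cycBlock 1 g₂ →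
        cycBlock 2 ω = cycBlock 2 g₃ → g₁ = g₂ ∧ g₂ = g₃) :
    Real.log G.card + ∑ s : D.supp, logMax ρ (power (tri (tensorCoords (D.comp s))) (c s)) ≤
      logMax ρ (power (tri (tensorCoords t)) N) := by
  have hblock : ∀ s ∈ D.supp, IsRestriction (tensorCoords (D.comp s))
      (block (fun i => (i.1 : ℤ)) (fun i => (i.1 : ℤ)) (fun i => (i.1 : ℤ)) D.coords s) :=
    fun s hs => D.isRestriction_comp hs
  have hcomp : ∀ s ∈ D.supp, tensorCoords (D.comp s) ≠ 0 := fun s hs =>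
    tensorCoords_ne_zero (D.comp_ne_zero hs)
  have h1 := log_card_add_sum_logMax_le ρ (t := D.coords)
    (fun i j k h => D.mem_supp_of_coords_ne_zero h)
    (fun s hs => (hblock s hs).ne_zero (hcomp s hs)) hG hGt hiso
  refine (add_le_add_right (Finset.sum_le_sum fun s _ => ?_) _).trans (h1.trans ?_)
  · exact logMax_mono ρ (power_ne_zero (tri_ne_zero (hcomp s s.2)) _)
      ((hblock s s.2).tri.power _)
  · exact logMax_mono ρ (power_ne_zero (tri_ne_zero (D.coords_ne_zero hs₀)) _)
      (D.isRestriction_coords.tri.power N)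

end TensorDecomposition

theorem theorem4p1 {F : Type*} [Field F] {U V W : Type*}
    [AddCommGroup U] [Module F U] [FiniteDimensional F U]
    [AddCommGroup V] [Module F V] [FiniteDimensional F V]
    [AddCommGroup W] [Module F W] [FiniteDimensional F W]
    (t : (U ⊗[F] V) ⊗[F] W) (D : TensorDecomposition t) (hD : IsTightSupport D.supp)
    (P : D.supp → ℝ) (hP : P ∈ stdSimplex ℝ D.supp) (ρ : ℝ) (hρ : ρ ∈ Set.Icc (2 : ℝ) 3) :
    TensorValueWellDefined ρ t ∧
    (∀ s ∈ D.supp, TensorValueWellDefined ρ (D.comp s)) ∧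
    Real.log (tensorValue ρ t) ≥
      (∑ l : Fin 3, marginalEntropy l P / 3) +
        (∑ s : D.supp, P s * Real.log (tensorValue ρ (D.comp s))) -
        entropyGap P := by
  have hsupp : ∃ s, s ∈ D.supp := by
    by_contra! h
    have : IsEmpty D.supp := ⟨fun s => h s s.2⟩
    simpa using hP.2
  obtain ⟨s₀, hs₀⟩ := hsupp
  have ht : tensorCoords t ≠ 0 := D.isRestriction_coords.ne_zero (D.coords_ne_zero hs₀)
  have hs : ∀ s ∈ D.supp, tensorCoords (D.comp s) ≠ 0 := fun s hs =>
    tensorCoords_ne_zero (D.comp_ne_zero hs)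
  obtain ⟨hw, -, hle⟩ := CoordTensor.tendsto_valueN hρ.2 ht
  have hws := fun s hs' => CoordTensor.tendsto_valueN hρ.2 (hs s hs')
  refine ⟨hw, fun s hs' => (hws s hs').1, ?_⟩
  have h := le_of_forall_isolated_triples hD hP
    (f := fun s n => CoordTensor.logMax ρ
      (CoordTensor.power (CoordTensor.tri (tensorCoords (D.comp s))) n))
    (fun s n => CoordTensor.logMax_nonneg ρ
      (CoordTensor.power_ne_zero (CoordTensor.tri_ne_zero (hs s s.2)) n))
    (fun s => (hws s s.2).2.1)
    fun N c G hG hGt hiso => (D.log_card_add_sum_le hs₀ ρ hG hGt hiso).trans (hle N)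
  have h2 : ∑ s : D.supp, P s * (3 * Real.log ((tensorCoords (D.comp s)).value ρ)) =
      3 * ∑ s : D.supp, P s * Real.log (tensorValue ρ (D.comp s)) := by
    rw [Finset.mul_sum]
    exact Finset.sum_congr rfl fun s _ => by rw [tensorValue]; ring
  rw [h2] at h
  rw [← Finset.sum_div, tensorValue]
  linarith
end
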